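/- Let $L>0$ and $T>0$. All functions are real-valued. Let $L^2_{x\,dx}$ be the Hilbert space of (classes of) measurable functions on $(0,L)$ with $\|u\|_{L^2_{xdx}}^2=\int_0^L u(x)^2\,x\,dx<\infty$, let $H^2_0(0,L)$ be the closure of $C_c^\infty(0,L)$ in $H^2(0,L)$, and let $H^{-2}(0,L)$ be the dual of $H^2_0(0,L)$. Consider the linear nonhomogeneous Kawahara system $$\begin{cases} u_t+u_x+u_{xxx}-u_{xxxxx}=f & \text{in }(0,T)\times(0,L),\\ u(t,0)=u(t,L)=u_x(t,0)=u_x(t,L)=u_{xx}(t,L)=0 & \text{in }(0,T),\\ u(0,x)=u_0(x) & \text{in }(0,L).\end{cases}\tag{1}$$ For $u_0\in L^2_{x\,dx}$ and $f\in L^2(0,T;H^{-2}(0,L))$, a solution of (1) in the class $C([0,T];L^2_{x\,dx})\cap L^2(0,T;H^2(0,L))$ is a function $u$ of this class such that $u(0)=u_0$, $u(t)\in H^2_0(0,L)$ for almost every $t\in(0,T)$, and, for every $t\in[0,T]$ and every $\psi\in C^\infty([0,L])$ with $\psi(0)=\psi'(0)=\psi''(0)=\psi(L)=\psi'(L)=0$,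 $$\int_0^L u(t)\psi\,dx-\int_0^L u_0\psi\,dx+\int_0^t\!\!\int_0^L\big(u_x\psi-u_{xx}\psi'+u_{xx}\psi'''\big)\,dx\,ds=\int_0^t\langle f(s),\psi\rangle_{H^{-2},H^2_0}\,ds$$ (the condition $u_{xx}(t,L)=0$ is imposed by leaving $\psi''(L)$ free). Then there is a constant $C>0$, depending only on $L$ and $T$, such that for all $u_0\in L^2_{x\,dx}$ and $f\in L^2(0,T;H^{-2}(0,L))$ the system (1) has a unique solution $u\in C([0,T];L^2_{x\,dx})\cap L^2(0,T;H^2(0,L))$, and $$\|u\|_{L^\infty(0,T;L^2_{x\,dx})}+\|u\|_{L^2(0,T;H^2(0,L))}\le C\big(\|u_0\|_{L^2_{x\,dx}}+\|f\|_{L^2(0,T;H^{-2}(0,L))}\big).$$ -/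

import Mathlib

open MeasureTheory Set
open scoped ContDiff

namespace Kawahara

noncomputable section

/-- Lebesgue measure on the interval `(0, L)`. -/
abbrev vol (L : ℝ) : Measure ℝ := volume.restrict (Ioo 0 L)

/-- The measure `x dx` on `(0, L)`. It has the same null sets as `vol L`. -/
abbrev xvol (L : ℝ) : Measure ℝ := (vol L).withDensity fun x => ENNReal.ofReal x

/-- `L²(0, L)`. -/
abbrev L2 (L : ℝ) : Type := Lp ℝ 2 (vol L)

/-- The weighted space `L²_{x dx}` on `(0, L)`, with `‖u‖² = ∫₀ᴸ u(x)² x dx`. -/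
abbrev L2x (L : ℝ) : Type := Lp ℝ 2 (xvol L)

/-- `φ ∈ C_c^∞(0, L)`. -/
structure IsTest (L : ℝ) (φ : ℝ → ℝ) : Prop where
  smooth : ContDiff ℝ ∞ φ
  compact : HasCompactSupport φ
  supp : tsupport φ ⊆ Ioo 0 L

/-- `v` is the weak derivative of `u` on `(0, L)`. -/
def IsWeakDeriv (L : ℝ) (u v : L2 L) : Prop :=
  ∀ φ : ℝ → ℝ, IsTest L φ →
    ∫ x in Ioo 0 L, u x * deriv φ x = - ∫ x in Ioo 0 L, v x * φ x

theorem integrable_mul_of_continuous {L : ℝ} (u : L2 L) {g : ℝ → ℝ} (hg : Continuous g)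
    (hc : HasCompactSupport g) : Integrable (fun x => u x * g x) (vol L) := by
  obtain ⟨C, hC⟩ := hc.exists_bound_of_continuous hg
  have hu : Integrable (fun x => u x) (vol L) := (Lp.memLp u).integrable (by norm_num)
  exact hu.mul_bdd hg.aestronglyMeasurable (Filter.Eventually.of_forall hC)

theorem IsTest.continuous_deriv {L : ℝ} {φ : ℝ → ℝ} (h : IsTest L φ) : Continuous (deriv φ) :=
  h.smooth.continuous_deriv (by simp)

theorem IsWeakDeriv.add {L : ℝ} {u v u' v' : L2 L} (h : IsWeakDeriv L u v)
    (h' : IsWeakDeriv L u' v') : IsWeakDeriv L (u + u') (v + v') := by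
  intro φ hφ
  have e1 : ∫ x in Ioo 0 L, (u + u' : L2 L) x * deriv φ x
      = ∫ x in Ioo 0 L, (u x * deriv φ x + u' x * deriv φ x) := by
    refine integral_congr_ae ?_
    filter_upwards [Lp.coeFn_add u u'] with x hx
    rw [hx, Pi.add_apply, add_mul]
  have e2 : ∫ x in Ioo 0 L, (v + v' : L2 L) x * φ x
      = ∫ x in Ioo 0 L, (v x * φ x + v' x * φ x) := by
    refine integral_congr_ae ?_
    filter_upwards [Lp.coeFn_add v v'] with x hx
    rw [hx, Pi.add_apply, add_mul]
  have hd := hφ.continuous_deriv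
  have hdc := hφ.compact.deriv
  have hc := hφ.smooth.continuous
  rw [e1, e2, integral_add (integrable_mul_of_continuous u hd hdc)
    (integrable_mul_of_continuous u' hd hdc),
    integral_add (integrable_mul_of_continuous v hc hφ.compact)
    (integrable_mul_of_continuous v' hc hφ.compact), h φ hφ, h' φ hφ]
  ring

theorem IsWeakDeriv.smul {L : ℝ} {u v : L2 L} (c : ℝ) (h : IsWeakDeriv L u v) :
    IsWeakDeriv L (c • u) (c • v) := by
  intro φ hφ
  have e1 : ∫ x in Ioo 0 L, (c • u : L2 L) x * deriv φ x
      = ∫ x in Ioo 0 L, c * (u x * deriv φ x) := by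
    refine integral_congr_ae ?_
    filter_upwards [Lp.coeFn_smul c u] with x hx
    rw [hx, Pi.smul_apply, smul_eq_mul, mul_assoc]
  have e2 : ∫ x in Ioo 0 L, (c • v : L2 L) x * φ x
      = ∫ x in Ioo 0 L, c * (v x * φ x) := by
    refine integral_congr_ae ?_
    filter_upwards [Lp.coeFn_smul c v] with x hx
    rw [hx, Pi.smul_apply, smul_eq_mul, mul_assoc]
  rw [e1, e2, integral_const_mul, integral_const_mul, h φ hφ]
  ring

theorem IsWeakDeriv.zero (L : ℝ) : IsWeakDeriv L 0 0 := by
  intro φ _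
  have h0 := Lp.coeFn_zero ℝ 2 (vol L)
  have e1 : ∫ x in Ioo 0 L, (0 : L2 L) x * deriv φ x = 0 := by
    refine integral_eq_zero_of_ae ?_
    filter_upwards [h0] with x hx
    rw [hx, Pi.zero_apply, zero_mul]
  have e2 : ∫ x in Ioo 0 L, (0 : L2 L) x * φ x = 0 := by
    refine integral_eq_zero_of_ae ?_
    filter_upwards [h0] with x hx
    rw [hx, Pi.zero_apply, zero_mul]
  rw [e1, e2, neg_zero]

/-- The Sobolev space `H²(0, L)`: an element is the triple `(u, u_x, u_xx)` in `L²(0, L)³` of a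
function and its weak derivatives, with `‖u‖² = ‖u‖²_{L²} + ‖u_x‖²_{L²} + ‖u_xx‖²_{L²}`. -/
def H2 (L : ℝ) : Submodule ℝ (PiLp 2 fun _ : Fin 3 => L2 L) where
  carrier := {U | IsWeakDeriv L (U 0) (U 1) ∧ IsWeakDeriv L (U 1) (U 2)}
  add_mem' := fun h h' => ⟨h.1.add h'.1, h.2.add h'.2⟩
  zero_mem' := ⟨IsWeakDeriv.zero L, IsWeakDeriv.zero L⟩
  smul_mem' := fun c _ h => ⟨h.1.smul c, h.2.smul c⟩

/-- The `k`-th weak derivative (`k = 0, 1, 2`) of an element of `H²(0, L)`. -/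
def H2.D {L : ℝ} (k : Fin 3) (u : H2 L) : L2 L := u.1 k

/-- `H²₀(0, L)`: the closure of `C_c^∞(0, L)` in `H²(0, L)`. -/
def H20 (L : ℝ) : Submodule ℝ (H2 L) :=
  (Submodule.span ℝ {u : H2 L | ∃ φ, IsTest L φ ∧ H2.D 0 u =ᵐ[vol L] φ}).topologicalClosure

/-- `H⁻²(0, L)`: the dual space of `H²₀(0, L)`, with the dual norm. -/
abbrev Hm2 (L : ℝ) : Type := H20 L →L[ℝ] ℝ

/-- `L²(0, T; H²(0, L))`. -/
abbrev L2H2 (L T : ℝ) : Type := Lp (H2 L) 2 (vol T)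

/-- `L²(0, T; H⁻²(0, L))`. -/
abbrev L2Hm2 (L T : ℝ) : Type := Lp (Hm2 L) 2 (vol T)

/-- `C([0, T]; L²_{x dx}) ∩ L²(0, T; H²(0, L))`: an element is given by its representatives in the
two spaces, which agree at almost every time. -/
@[ext]
structure SolSpace (L T : ℝ) where
  /-- `u` as an element of `C([0, T]; L²_{x dx})`, normed by the supremum norm. -/
  toC : C(Icc (0 : ℝ) T, L2x L)
  /-- `u` as an element of `L²(0, T; H²(0, L))`. -/
  toL2H2 : L2H2 L T
  compat : ∀ᵐ t ∂(vol T), ∀ ht : t ∈ Icc (0 : ℝ) T, toC ⟨t, ht⟩ =ᵐ[vol L] H2.D 0 (toL2H2 t)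

/-- Admissible test functions: `ψ ∈ C^∞([0, L])` with
`ψ(0) = ψ'(0) = ψ''(0) = ψ(L) = ψ'(L) = 0`, where `w` is `ψ` as an element of `H²₀(0, L)`
(this membership expresses the conditions on `ψ` and `ψ'`). -/
structure IsAdmissible (L : ℝ) (ψ : ℝ → ℝ) (w : H20 L) : Prop where
  smooth : ContDiff ℝ ∞ ψ
  eq : H2.D 0 (w : H2 L) =ᵐ[vol L] ψ
  deriv_two_zero : iteratedDeriv 2 ψ 0 = 0

/-- `u` is a (weak) solution of
`u_t + u_x + u_xxx - u_xxxxx = f` in `(0, T) × (0, L)`,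
`u(t, 0) = u(t, L) = u_x(t, 0) = u_x(t, L) = u_xx(t, L) = 0`, `u(0, ·) = u₀`.

The first four boundary conditions are `u(t) ∈ H²₀(0, L)`. The condition `u_xx(t, L) = 0` is the
natural boundary condition of the weak formulation: `ψ''(L)` is free, while `ψ''(0) = 0`. -/
structure IsSolution {L T : ℝ} (u₀ : L2x L) (f : L2Hm2 L T) (u : SolSpace L T) : Prop where
  initial : ∀ h : (0 : ℝ) ∈ Icc (0 : ℝ) T, u.toC ⟨0, h⟩ = u₀
  boundary : ∀ᵐ t ∂(vol T), u.toL2H2 t ∈ H20 L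
  weak : ∀ (ψ : ℝ → ℝ) (w : H20 L), IsAdmissible L ψ w → ∀ t : Icc (0 : ℝ) T,
    (∫ x in Ioo 0 L, u.toC t x * ψ x) - (∫ x in Ioo 0 L, u₀ x * ψ x)
      + ∫ s in Ioo 0 (t : ℝ),
          ((∫ x in Ioo 0 L, H2.D 1 (u.toL2H2 s) x * ψ x)
            - (∫ x in Ioo 0 L, H2.D 2 (u.toL2H2 s) x * deriv ψ x)
            + (∫ x in Ioo 0 L, H2.D 2 (u.toL2H2 s) x * iteratedDeriv 3 ψ x))
      = ∫ s in Ioo 0 (t : ℝ), f s w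

end

end Kawahara

/-! ### Integration by parts and primitives of test functions. -/

namespace Kawahara

/-! The boundary conditions on a test function `ψ` say exactly that `ψ = x v` with `v` smooth and in
`H²₀`. Hence `∫ u ψ` is the `x dx` inner product of `u` and `v`, and the system becomes an abstract
equation `u_t + A u = f` in `L²_{x dx}`, with `A` known only through its action on such `v`. The
spatial term is a bounded form on `H²₀` plus `∫ x u_xx v_xxx`, which is unbounded in `v`.

The operator enters through two estimates with the same quadratic form `5/2 |u_xx|² + 3/2 |u_x|² -
1/2 |u|²`, coercive up to a multiple of the weighted norm (`garding`). On test vectors, integration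
by parts leaves a boundary term at `L` of favourable sign (`inner_D2_core_ge`). For an arbitrary `u`
in `H²₀` solving a stationary equation `A u = M`, there is an exact identity (`energy_identity`).
Such a `u` is too rough for direct integration by parts; instead the equation shows that `x u_xx` is
minus the derivative of an element `w` of `H²₀`, and Hardy's identity for `w` supplies the missing
term.

Existence: the first estimate and Lions' projection theorem give resolvents of size independent of
the parameter. The resulting exponential-in-time solutions, with the stationary ones, have dense
data (`IsDissipative.dense_data`): a functional annihilating these data has bounded exponential
moments in time, hence no forcing component. The energy estimate then carries solutions over to all
data by a limit. Uniqueness: the time integral of a solution with zero data solves a stationary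
equation at each time, so the energy identity and Gronwall apply without time regularity
(`IsDissipative.eq_zero_of_isWeakSol`). -/

theorem setIntegral_Ioo_eq_intervalIntegral {L : ℝ} (hL : 0 ≤ L) (f : ℝ → ℝ) :
    ∫ x in Ioo 0 L, f x = ∫ x in (0 : ℝ)..L, f x := by
  rw [intervalIntegral.integral_of_le hL, integral_Ioc_eq_integral_Ioo]

theorem _root_.Continuous.integrable_vol {f : ℝ → ℝ} (hf : Continuous f) (L : ℝ) :
    Integrable f (vol L) :=
  (hf.integrableOn_Icc (a := 0) (b := L)).mono_set Ioo_subset_Icc_self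

theorem _root_.ContDiff.deriv_infty {f : ℝ → ℝ} (hf : ContDiff ℝ ∞ f) : ContDiff ℝ ∞ (deriv f) :=
  (contDiff_infty_iff_deriv.1 hf).2

theorem _root_.ContDiff.differentiable_infty {f : ℝ → ℝ} (hf : ContDiff ℝ ∞ f) :
    Differentiable ℝ f :=
  (contDiff_infty_iff_deriv.1 hf).1

theorem integral_deriv_mul {L : ℝ} (hL : 0 ≤ L) {f g : ℝ → ℝ} (hf : ContDiff ℝ ∞ f)
    (hg : ContDiff ℝ ∞ g) :
    ∫ x in Ioo 0 L, deriv f x * g x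
      = f L * g L - f 0 * g 0 - ∫ x in Ioo 0 L, f x * deriv g x := by
  have h1 := intervalIntegral.integral_deriv_mul_eq_sub (a := 0) (b := L)
    (fun x _ => (hf.differentiable_infty x).hasDerivAt)
    (fun x _ => (hg.differentiable_infty x).hasDerivAt)
    (hf.deriv_infty.continuous.intervalIntegrable _ _)
    (hg.deriv_infty.continuous.intervalIntegrable _ _)
  have i1 : Integrable (fun x => deriv f x * g x) (vol L) :=
    (hf.deriv_infty.continuous.mul hg.continuous).integrable_vol L
  have i2 : Integrable (fun x => f x * deriv g x) (vol L) :=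
    (hf.continuous.mul hg.deriv_infty.continuous).integrable_vol L
  rw [← setIntegral_Ioo_eq_intervalIntegral hL, integral_add i1 i2] at h1
  linarith

namespace IsTest

variable {L : ℝ} {φ ψ : ℝ → ℝ}

theorem eq_zero_of_notMem (h : IsTest L φ) {x : ℝ} (hx : x ∉ Ioo 0 L) : φ x = 0 :=
  image_eq_zero_of_notMem_tsupport fun h' => hx (h.supp h')

theorem at_zero (h : IsTest L φ) : φ 0 = 0 := h.eq_zero_of_notMem (by simp)

theorem at_end (h : IsTest L φ) : φ L = 0 := h.eq_zero_of_notMem (by simp)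

theorem deriv (h : IsTest L φ) : IsTest L (deriv φ) where
  smooth := h.smooth.deriv_infty
  compact := h.compact.deriv
  supp := (closure_minimal (support_deriv_subset (f := φ)) (isClosed_tsupport _)).trans h.supp

theorem mul_left (h : IsTest L φ) {g : ℝ → ℝ} (hg : ContDiff ℝ ∞ g) :
    IsTest L (fun x => g x * φ x) where
  smooth := hg.mul h.smooth
  compact := h.compact.mul_left
  supp := (tsupport_mul_subset_right).trans h.supp

theorem add (h : IsTest L φ) (h' : IsTest L ψ) : IsTest L (fun x => φ x + ψ x) where
  smooth := h.smooth.add h'.smooth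
  compact := h.compact.add h'.compact
  supp := (tsupport_add φ ψ).trans (union_subset h.supp h'.supp)

theorem const_mul (h : IsTest L φ) (c : ℝ) : IsTest L (fun x => c * φ x) :=
  h.mul_left contDiff_const

theorem neg (h : IsTest L φ) : IsTest L (fun x => - φ x) := by
  simpa using h.const_mul (-1)

theorem sub (h : IsTest L φ) (h' : IsTest L ψ) : IsTest L (fun x => φ x - ψ x) := by
  simpa [sub_eq_add_neg] using h.add h'.neg

theorem zero (L : ℝ) : IsTest L (fun _ => 0) where
  smooth := contDiff_const
  compact := HasCompactSupport.zero
  supp := by simp [tsupport]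

end IsTest

theorem integral_test_mul_deriv {L : ℝ} (hL : 0 ≤ L) {φ g : ℝ → ℝ} (hφ : IsTest L φ)
    (hg : ContDiff ℝ ∞ g) :
    ∫ x in Ioo 0 L, deriv φ x * g x = - ∫ x in Ioo 0 L, φ x * deriv g x := by
  rw [integral_deriv_mul hL hφ.smooth hg, hφ.at_zero, hφ.at_end]; ring

theorem hasDerivAt_primitive {f : ℝ → ℝ} (hf : Continuous f) (x : ℝ) :
    HasDerivAt (fun x => ∫ y in (0 : ℝ)..x, f y) (f x) x :=
  (hf.integral_hasStrictDerivAt 0 x).hasDerivAt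

theorem deriv_primitive {f : ℝ → ℝ} (hf : Continuous f) :
    deriv (fun x => ∫ y in (0 : ℝ)..x, f y) = f :=
  funext fun x => (hasDerivAt_primitive hf x).deriv

theorem contDiff_primitive {f : ℝ → ℝ} (hf : ContDiff ℝ ∞ f) :
    ContDiff ℝ ∞ (fun x => ∫ y in (0 : ℝ)..x, f y) := by
  rw [contDiff_infty_iff_deriv, deriv_primitive hf.continuous]
  exact ⟨fun x => (hasDerivAt_primitive hf.continuous x).differentiableAt, hf⟩

/-- The primitive from `0` vanishes to the left of the support of `η`; zero mean makes it vanish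
again to the right, so compact support survives. -/
theorem IsTest.exists_primitive {L : ℝ} (hL : 0 < L) {η : ℝ → ℝ} (hη : IsTest L η)
    (h0 : ∫ x in Ioo 0 L, η x = 0) :
    ∃ φ, IsTest L φ ∧ _root_.deriv φ = η := by
  obtain ⟨a, b, ha, hb, hab, hs⟩ : ∃ a b, 0 < a ∧ b < L ∧ a ≤ b ∧ tsupport η ⊆ Icc a b := by
    rcases (tsupport η).eq_empty_or_nonempty with he | hne
    · exact ⟨L / 2, L / 2, by linarith, by linarith, le_rfl, by simp [he]⟩
    · obtain ⟨a, ha, ha'⟩ := hη.compact.isCompact.exists_isLeast hne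
      obtain ⟨b, hb, hb'⟩ := hη.compact.isCompact.exists_isGreatest hne
      exact ⟨a, b, (hη.supp ha).1, (hη.supp hb).2, ha' hb, fun x hx => ⟨ha' hx, hb' hx⟩⟩
  have hz : ∀ x, x ∉ Icc a b → η x = 0 := fun x hx =>
    image_eq_zero_of_notMem_tsupport fun h => hx (hs h)
  have hsupp : Function.support (fun x => ∫ y in (0 : ℝ)..x, η y) ⊆ Icc a b := by
    intro x hx
    by_contra hxn
    apply hx
    have hcase : x < a ∨ b < x := by
      by_contra! h
      exact hxn ⟨h.1, h.2⟩
    rcases hcase with h | h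
    · refine intervalIntegral.integral_zero_ae (Filter.Eventually.of_forall fun y hy => ?_)
      refine hz y fun hy' => ?_
      rcases hy with ⟨_, hy⟩
      have : y ≤ max 0 x := hy
      rcases le_max_iff.1 this with h1 | h1 <;> linarith [hy'.1]
    · have e1 : ∫ y in x..L, η y = 0 := by
        refine intervalIntegral.integral_zero_ae (Filter.Eventually.of_forall fun y hy => ?_)
        refine hz y fun hy' => ?_
        have : min x L < y := hy.1
        rcases min_lt_iff.1 this with h1 | h1 <;> linarith [hy'.2]
      rw [setIntegral_Ioo_eq_intervalIntegral hL.le,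
        ← intervalIntegral.integral_add_adjacent_intervals (b := x)
        (hη.smooth.continuous.intervalIntegrable _ _)
        (hη.smooth.continuous.intervalIntegrable _ _), e1, add_zero] at h0
      exact h0
  have hts : tsupport (fun x => ∫ y in (0 : ℝ)..x, η y) ⊆ Icc a b :=
    closure_minimal hsupp isClosed_Icc
  exact ⟨_, ⟨contDiff_primitive hη.smooth,
    isCompact_Icc.of_isClosed_subset (isClosed_tsupport _) hts,
    hts.trans fun x hx => ⟨ha.trans_le hx.1, hx.2.trans_lt hb⟩⟩,
    deriv_primitive hη.smooth.continuous⟩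

/-- With `b` a bump of integral 1, `-b'` has moments `0` and `1`, and adding `m b'` to `b` cancels
its first moment `m`. The pair serves to correct the moments of arbitrary test functions. -/
theorem exists_test_moments {L : ℝ} (hL : 0 < L) :
    ∃ θ₀ θ₁ : ℝ → ℝ, IsTest L θ₀ ∧ IsTest L θ₁ ∧ (∫ x in Ioo 0 L, θ₀ x = 1) ∧
      (∫ x in Ioo 0 L, x * θ₀ x = 0) ∧ (∫ x in Ioo 0 L, θ₁ x = 0) ∧
      (∫ x in Ioo 0 L, x * θ₁ x = 1) := by
  let B : ContDiffBump (L / 2) := ⟨L / 8, L / 4, by positivity, by linarith⟩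
  have hB : IsTest L B := by
    refine ⟨B.contDiff, B.hasCompactSupport, ?_⟩
    rw [B.tsupport_eq, Real.closedBall_eq_Icc]
    intro x hx
    have h1 := hx.1
    have h2 := hx.2
    change L / 2 - L / 4 ≤ x at h1
    change x ≤ L / 2 + L / 4 at h2
    constructor <;> linarith
  have hpos : 0 < ∫ x in Ioo 0 L, B x := by
    rw [setIntegral_Ioo_eq_intervalIntegral hL.le]
    refine intervalIntegral.integral_pos hL B.continuous.continuousOn
      (fun x _ => B.nonneg) ⟨L / 2, ⟨by linarith, by linarith⟩, ?_⟩
    exact B.pos_of_mem_ball (Metric.mem_ball_self B.rOut_pos)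
  obtain ⟨I, hI⟩ : ∃ I, I = ∫ x in Ioo 0 L, B x := ⟨_, rfl⟩
  rw [← hI] at hpos
  have hb : IsTest L (fun x => I⁻¹ * B x) := hB.const_mul _
  have hb1 : ∫ x in Ioo 0 L, I⁻¹ * B x = 1 := by
    rw [integral_const_mul, ← hI, inv_mul_cancel₀ hpos.ne']
  generalize (fun x => I⁻¹ * B x) = b at hb hb1
  have hd0 : ∫ x in Ioo 0 L, deriv b x = 0 := by
    have := integral_test_mul_deriv hL.le hb (contDiff_const (c := (1 : ℝ)))
    simpa using this
  have hd1 : ∫ x in Ioo 0 L, x * deriv b x = -1 := by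
    have := integral_test_mul_deriv hL.le hb contDiff_id
    simp only [deriv_id', id, mul_one, hb1] at this
    simpa [mul_comm] using this
  set m := ∫ x in Ioo 0 L, x * b x with hm
  have ib := hb.smooth.continuous.integrable_vol L
  have idb := hb.deriv.smooth.continuous.integrable_vol L
  have ixb : Integrable (fun x => x * b x) (vol L) := (continuous_id.mul hb.smooth.continuous).integrable_vol L
  have ixd : Integrable (fun x => x * deriv b x) (vol L) := (continuous_id.mul hb.deriv.smooth.continuous).integrable_vol L
  refine ⟨fun x => b x + m * deriv b x, fun x => - deriv b x, hb.add (hb.deriv.const_mul m),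
    hb.deriv.neg, ?_, ?_, ?_, ?_⟩
  · rw [integral_add ib (idb.const_mul _), integral_const_mul, hd0, hb1]; ring
  · have : ∀ x, x * (b x + m * deriv b x) = x * b x + m * (x * deriv b x) := fun x => by ring
    simp_rw [this]
    rw [integral_add ixb (ixd.const_mul _), integral_const_mul, hd1, ← hm]; ring
  · rw [integral_neg, hd0, neg_zero]
  · simp_rw [mul_neg]
    rw [integral_neg, hd1, neg_neg]

/-- A test function minus its first two moments is the second derivative of a test function. -/
theorem IsTest.exists_second_primitive {L : ℝ} (hL : 0 < L) {η : ℝ → ℝ} (hη : IsTest L η)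
    (h0 : ∫ x in Ioo 0 L, η x = 0) (h1 : ∫ x in Ioo 0 L, x * η x = 0) :
    ∃ φ, IsTest L φ ∧ _root_.deriv (_root_.deriv φ) = η := by
  obtain ⟨φ₁, hφ₁, rfl⟩ := hη.exists_primitive hL h0
  have : ∫ x in Ioo 0 L, φ₁ x = 0 := by
    have := integral_test_mul_deriv hL.le hφ₁ contDiff_id
    simp only [deriv_id', id, mul_one] at this
    simp only [mul_comm] at h1 this
    linarith
  obtain ⟨φ, hφ, rfl⟩ := hφ₁.exists_primitive hL this
  exact ⟨φ, hφ, rfl⟩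

end Kawahara

/-! ### Classes in `L²`, weak derivatives, and the Hilbert spaces `H²` and `H²₀`. -/

namespace Kawahara

noncomputable section

variable {L : ℝ}

theorem _root_.Continuous.memLp_vol {E : Type*} [NormedAddCommGroup E] {f : ℝ → E}
    (hf : Continuous f) (L : ℝ) :
    MemLp f 2 (vol L) := by
  obtain ⟨C, hC⟩ := isCompact_Icc.exists_bound_of_continuousOn (s := Icc 0 L) hf.continuousOn
  refine MemLp.of_bound hf.aestronglyMeasurable C ?_
  exact (ae_restrict_mem measurableSet_Ioo).mono fun x hx => hC x (Ioo_subset_Icc_self hx)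

open Classical in
/-- The class in `L²(0, L)` of a continuous function on the line. -/
def toL2 (L : ℝ) (f : ℝ → ℝ) : L2 L :=
  if hf : Continuous f then (hf.memLp_vol L).toLp f else 0

theorem toL2_coe {f : ℝ → ℝ} (hf : Continuous f) : toL2 L f =ᵐ[vol L] f := by
  rw [toL2, dif_pos hf]; exact MemLp.coeFn_toLp _

theorem eq_toL2 {u : L2 L} {f : ℝ → ℝ} (hf : Continuous f) (h : u =ᵐ[vol L] f) :
    u = toL2 L f :=
  Lp.ext (h.trans (toL2_coe hf).symm)

theorem inner_eq_integral (u v : L2 L) : inner ℝ u v = ∫ x in Ioo 0 L, u x * v x := by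
  rw [L2.inner_def]
  exact integral_congr_ae (Filter.Eventually.of_forall fun x => by simp [mul_comm])

theorem inner_toL2 (u : L2 L) {f : ℝ → ℝ} (hf : Continuous f) :
    inner ℝ u (toL2 L f) = ∫ x in Ioo 0 L, u x * f x := by
  rw [inner_eq_integral]
  refine integral_congr_ae ?_
  filter_upwards [toL2_coe hf] with x hx
  rw [hx]

theorem inner_toL2_toL2 {f g : ℝ → ℝ} (hf : Continuous f) (hg : Continuous g) :
    inner ℝ (toL2 L f) (toL2 L g) = ∫ x in Ioo 0 L, f x * g x := by
  rw [inner_toL2 _ hg]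
  refine integral_congr_ae ?_
  filter_upwards [toL2_coe (L := L) hf] with x hx
  rw [hx]

theorem toL2_add {f g : ℝ → ℝ} (hf : Continuous f) (hg : Continuous g) :
    toL2 L (fun x => f x + g x) = toL2 L f + toL2 L g := by
  refine (eq_toL2 (hf.add hg) ?_).symm
  filter_upwards [toL2_coe (L := L) hf, toL2_coe (L := L) hg, Lp.coeFn_add (toL2 L f) (toL2 L g)]
    with x h1 h2 h3
  rw [h3, Pi.add_apply, h1, h2]; rfl

theorem toL2_const_mul {f : ℝ → ℝ} (c : ℝ) (hf : Continuous f) :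
    toL2 L (fun x => c * f x) = c • toL2 L f := by
  refine (eq_toL2 (continuous_const.mul hf) ?_).symm
  filter_upwards [toL2_coe (L := L) hf, Lp.coeFn_smul c (toL2 L f)] with x h1 h2
  rw [h2, Pi.smul_apply, h1, smul_eq_mul]; rfl

theorem toL2_sub {f g : ℝ → ℝ} (hf : Continuous f) (hg : Continuous g) :
    toL2 L (fun x => f x - g x) = toL2 L f - toL2 L g := by
  refine (eq_toL2 (hf.sub hg) ?_).symm
  filter_upwards [toL2_coe (L := L) hf, toL2_coe (L := L) hg, Lp.coeFn_sub (toL2 L f) (toL2 L g)]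
    with x h1 h2 h3
  rw [h3, Pi.sub_apply, h1, h2]; rfl

/-- An element of `L²(0, L)` orthogonal to all test functions vanishes. -/
theorem eq_zero_of_inner_test (u : L2 L)
    (h : ∀ φ, IsTest L φ → ∫ x in Ioo 0 L, u x * φ x = 0) : u = 0 := by
  have hint : IntegrableOn (fun x => u x) (Ioo 0 L) :=
    (Lp.memLp u).integrable (by norm_num)
  have := isOpen_Ioo.ae_eq_zero_of_integral_contDiff_smul_eq_zero (μ := volume)
    hint.locallyIntegrableOn fun g hg hc hs => by
      have h2 := h g ⟨hg, hc, hs⟩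
      rw [setIntegral_eq_integral_of_forall_compl_eq_zero] at h2
      · simpa [mul_comm] using h2
      · intro x hx
        rw [image_eq_zero_of_notMem_tsupport fun h' => hx (hs h'), mul_zero]
  refine Lp.ext ?_
  filter_upwards [(ae_restrict_iff' measurableSet_Ioo).2 this, Lp.coeFn_zero ℝ 2 (vol L)]
    with x h1 h2
  rw [h1, h2, Pi.zero_apply]

theorem eq_of_inner_toL2_test {u v : L2 L}
    (h : ∀ φ, IsTest L φ → inner ℝ u (toL2 L φ) = inner ℝ v (toL2 L φ)) : u = v := by
  rw [← sub_eq_zero]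
  refine eq_zero_of_inner_test _ fun φ hφ => ?_
  rw [← inner_toL2 _ hφ.smooth.continuous, inner_sub_left, h φ hφ, sub_self]

theorem isWeakDeriv_iff (u v : L2 L) : IsWeakDeriv L u v ↔ ∀ φ : ℝ → ℝ, IsTest L φ →
    inner ℝ u (toL2 L (deriv φ)) = - inner ℝ v (toL2 L φ) := by
  refine forall₂_congr fun φ hφ => ?_
  rw [inner_toL2 _ hφ.continuous_deriv, inner_toL2 _ hφ.smooth.continuous]

/-- The weak derivative operator is single-valued. -/
theorem IsWeakDeriv.unique {u v w : L2 L} (h : IsWeakDeriv L u v) (h' : IsWeakDeriv L u w) :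
    v = w := by
  rw [isWeakDeriv_iff] at h h'
  refine eq_of_inner_toL2_test fun φ hφ => ?_
  linarith [h φ hφ, h' φ hφ]

theorem isWeakDeriv_toL2 (hL : 0 ≤ L) {f : ℝ → ℝ} (hf : ContDiff ℝ ∞ f) :
    IsWeakDeriv L (toL2 L f) (toL2 L (deriv f)) := by
  rw [isWeakDeriv_iff]
  intro φ hφ
  rw [inner_toL2_toL2 hf.continuous hφ.continuous_deriv,
    inner_toL2_toL2 hf.deriv_infty.continuous hφ.smooth.continuous]
  have := integral_test_mul_deriv hL hφ hf
  simp only [mul_comm (deriv f _), mul_comm (f _)]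
  linarith

theorem isClosed_isWeakDeriv (L : ℝ) : IsClosed {p : L2 L × L2 L | IsWeakDeriv L p.1 p.2} := by
  simp only [isWeakDeriv_iff, ofPred_forall]
  refine isClosed_iInter fun φ => isClosed_iInter fun _ => ?_
  exact isClosed_eq (by fun_prop) (by fun_prop)

theorem isClosed_H2 (L : ℝ) : IsClosed (H2 L : Set (PiLp 2 fun _ : Fin 3 => L2 L)) := by
  have c : ∀ k, Continuous fun U : PiLp 2 (fun _ : Fin 3 => L2 L) => U k := fun k => by fun_prop
  exact ((isClosed_isWeakDeriv L).preimage ((c 0).prodMk (c 1))).inter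
    ((isClosed_isWeakDeriv L).preimage ((c 1).prodMk (c 2)))

instance (L : ℝ) : CompleteSpace (H2 L) := (isClosed_H2 L).completeSpace_coe

instance (L : ℝ) : CompleteSpace (H20 L) :=
  (Submodule.isClosed_topologicalClosure _).completeSpace_coe

namespace H2

/-- `H2.D` as a continuous linear map. -/
def DL (L : ℝ) (k : Fin 3) : H2 L →L[ℝ] L2 L :=
  (PiLp.proj 2 (fun _ : Fin 3 => L2 L) k).comp (H2 L).subtypeL

@[fun_prop] theorem continuous_D (k : Fin 3) : Continuous (D k : H2 L → L2 L) :=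
  (DL L k).continuous

@[simp] theorem D_add (k : Fin 3) (u v : H2 L) : D k (u + v) = D k u + D k v := rfl
@[simp] theorem D_sub (k : Fin 3) (u v : H2 L) : D k (u - v) = D k u - D k v := rfl
@[simp] theorem D_smul (k : Fin 3) (c : ℝ) (u : H2 L) : D k (c • u) = c • D k u := rfl

theorem isWeakDeriv_zero_one (u : H2 L) : IsWeakDeriv L (D 0 u) (D 1 u) := u.2.1
theorem isWeakDeriv_one_two (u : H2 L) : IsWeakDeriv L (D 1 u) (D 2 u) := u.2.2

theorem norm_sq (u : H2 L) : ‖u‖ ^ 2 = ‖D 0 u‖ ^ 2 + ‖D 1 u‖ ^ 2 + ‖D 2 u‖ ^ 2 := by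
  rw [Submodule.coe_norm, PiLp.norm_sq_eq_of_L2, Fin.sum_univ_three]; rfl

theorem ext_D0 {u v : H2 L} (h : D 0 u = D 0 v) : u = v := by
  have h1 : D 1 u = D 1 v := (isWeakDeriv_zero_one u).unique (h ▸ (H2.isWeakDeriv_zero_one v))
  have h2 : D 2 u = D 2 v := (H2.isWeakDeriv_one_two u).unique (h1 ▸ (H2.isWeakDeriv_one_two v))
  refine Subtype.ext (PiLp.ext fun k => ?_)
  fin_cases k
  exacts [h, h1, h2]

/-- Constructor of `H²(0, L)`. -/
def mk (u₀ u₁ u₂ : L2 L) (h : IsWeakDeriv L u₀ u₁) (h' : IsWeakDeriv L u₁ u₂) : H2 L :=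
  ⟨WithLp.toLp 2 ![u₀, u₁, u₂], h, h'⟩

/-- The class in `H²(0, L)` of a smooth function. -/
def ofSmooth (hL : 0 ≤ L) {f : ℝ → ℝ} (hf : ContDiff ℝ ∞ f) : H2 L :=
  mk (toL2 L f) (toL2 L (deriv f)) (toL2 L (deriv (deriv f))) (isWeakDeriv_toL2 hL hf)
    (isWeakDeriv_toL2 hL hf.deriv_infty)

theorem D1_eq (hL : 0 ≤ L) {u : H2 L} {f : ℝ → ℝ} (hf : ContDiff ℝ ∞ f) (h : D 0 u = toL2 L f) :
    D 1 u = toL2 L (deriv f) :=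
  (H2.isWeakDeriv_zero_one u).unique (h ▸ isWeakDeriv_toL2 hL hf)

theorem D2_eq (hL : 0 ≤ L) {u : H2 L} {f : ℝ → ℝ} (hf : ContDiff ℝ ∞ f) (h : D 0 u = toL2 L f) :
    D 2 u = toL2 L (deriv (deriv f)) :=
  (H2.isWeakDeriv_one_two u).unique (D1_eq hL hf h ▸ isWeakDeriv_toL2 hL hf.deriv_infty)

end H2

/-- The subspace of test functions in `H²(0, L)`. -/
def testSubmodule (L : ℝ) : Submodule ℝ (H2 L) where
  carrier := {u | ∃ φ, IsTest L φ ∧ H2.D 0 u = toL2 L φ}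
  add_mem' := by
    rintro u v ⟨φ, hφ, h⟩ ⟨ψ, hψ, h'⟩
    exact ⟨_, hφ.add hψ, by rw [H2.D_add, h, h', toL2_add hφ.smooth.continuous
      hψ.smooth.continuous]⟩
  zero_mem' := ⟨_, IsTest.zero L, (eq_toL2 continuous_const (Lp.coeFn_zero ℝ 2 (vol L)))⟩
  smul_mem' := by
    rintro c u ⟨φ, hφ, h⟩
    exact ⟨_, hφ.const_mul c, by rw [H2.D_smul, h, toL2_const_mul c hφ.smooth.continuous]⟩

theorem H20_eq (L : ℝ) : H20 L = (testSubmodule L).topologicalClosure := by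
  rw [H20]
  congr 1
  refine le_antisymm (Submodule.span_le.2 ?_) fun u hu => Submodule.subset_span ?_
  · rintro u ⟨φ, hφ, h⟩
    exact ⟨φ, hφ, eq_toL2 hφ.smooth.continuous h⟩
  · obtain ⟨φ, hφ, h⟩ := hu
    exact ⟨φ, hφ, h ▸ toL2_coe hφ.smooth.continuous⟩

theorem testSubmodule_le (L : ℝ) : testSubmodule L ≤ H20 L :=
  H20_eq L ▸ Submodule.le_topologicalClosure _

/-- A closed property of test functions holds on `H²₀(0, L)`. -/
theorem H20_induction {p : H2 L → Prop} (hL : 0 ≤ L) (hp : IsClosed {u | p u})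
    (h : ∀ φ u, IsTest L φ → H2.D 0 u = toL2 L φ → H2.D 1 u = toL2 L (deriv φ) →
      H2.D 2 u = toL2 L (deriv (deriv φ)) → p u) {u : H2 L} (hu : u ∈ H20 L) : p u := by
  rw [H20_eq] at hu
  refine closure_minimal (t := {u | p u}) ?_ hp hu
  rintro v ⟨φ, hφ, hv⟩
  exact h φ v hφ hv (H2.D1_eq hL hφ.smooth hv) (H2.D2_eq hL hφ.smooth hv)

end

end Kawahara

/-! ### Multiplication by `x` and the weighted space. -/

namespace Kawahara

noncomputable section

variable {L : ℝ}

theorem abs_le_of_mem_Ioo {x : ℝ} (hx : x ∈ Ioo 0 L) : |x| ≤ |L| := by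
  rw [abs_of_pos hx.1]; exact hx.2.le.trans (le_abs_self L)

theorem ae_norm_mul_le (u : ℝ → ℝ) : ∀ᵐ x ∂(vol L), ‖x * u x‖ ≤ |L| * ‖u x‖ :=
  (ae_restrict_mem measurableSet_Ioo).mono fun x hx => by
    rw [norm_mul]
    exact mul_le_mul_of_nonneg_right (abs_le_of_mem_Ioo hx) (norm_nonneg _)

theorem memLp_mulX (u : L2 L) : MemLp (fun x => x * u x) 2 (vol L) :=
  (Lp.memLp u).of_le_mul (by fun_prop) (ae_norm_mul_le _)

/-- Multiplication by `x` on `L²(0, L)`. -/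
def mulX (L : ℝ) : L2 L →L[ℝ] L2 L :=
  LinearMap.mkContinuous
    { toFun := fun u => (memLp_mulX u).toLp
      map_add' := fun u v => by
        refine Lp.ext ?_
        filter_upwards [(memLp_mulX u).coeFn_toLp, (memLp_mulX v).coeFn_toLp,
          (memLp_mulX (u + v)).coeFn_toLp, Lp.coeFn_add u v,
          Lp.coeFn_add (memLp_mulX u).toLp (memLp_mulX v).toLp] with x h1 h2 h3 h4 h5
        rw [h3, h5, Pi.add_apply, h1, h2, h4, Pi.add_apply, mul_add]
      map_smul' := fun c u => by
        refine Lp.ext ?_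
        filter_upwards [(memLp_mulX u).coeFn_toLp, (memLp_mulX (c • u)).coeFn_toLp,
          Lp.coeFn_smul c u, Lp.coeFn_smul c (memLp_mulX u).toLp] with x h1 h2 h3 h4
        rw [h2, RingHom.id_apply, h4, Pi.smul_apply, h1, h3, Pi.smul_apply, smul_eq_mul,
          smul_eq_mul]
        ring }
    |L| fun u => by
      refine Lp.norm_le_mul_norm_of_ae_le_mul ?_
      filter_upwards [(memLp_mulX u).coeFn_toLp, ae_norm_mul_le (L := L) u] with x h1 h2
      exact (congrArg norm h1).trans_le h2

theorem mulX_coe (u : L2 L) : mulX L u =ᵐ[vol L] fun x => x * u x := (memLp_mulX u).coeFn_toLp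

theorem norm_mulX_le (u : L2 L) : ‖mulX L u‖ ≤ |L| * ‖u‖ :=
  LinearMap.mkContinuous_norm_le _ (abs_nonneg L) _ |> (mulX L).le_of_opNorm_le <| u

theorem mulX_toL2 {f : ℝ → ℝ} (hf : Continuous f) :
    mulX L (toL2 L f) = toL2 L (fun x => x * f x) := by
  refine eq_toL2 (continuous_id.mul hf) ?_
  filter_upwards [mulX_coe (toL2 L f), toL2_coe (L := L) hf] with x h1 h2
  rw [h1, h2]

theorem inner_mulX_left (u v : L2 L) : inner ℝ (mulX L u) v = inner ℝ u (mulX L v) := by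
  rw [inner_eq_integral, inner_eq_integral]
  refine integral_congr_ae ?_
  filter_upwards [mulX_coe u, mulX_coe v] with x h1 h2
  rw [h1, h2]; ring

theorem mulX_injective : Function.Injective (mulX L) := by
  rw [injective_iff_map_eq_zero]
  intro u hu
  refine Lp.ext ?_
  have hu' := mulX_coe u
  rw [hu] at hu'
  filter_upwards [hu', Lp.coeFn_zero ℝ 2 (vol L), ae_restrict_mem measurableSet_Ioo] with x h1 h2 h3
  rw [h2, Pi.zero_apply] at h1 ⊢
  exact (mul_eq_zero.1 h1.symm).resolve_left h3.1.ne'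

theorem IsWeakDeriv.mulX {u v : L2 L} (h : IsWeakDeriv L u v) :
    IsWeakDeriv L (mulX L u) (u + Kawahara.mulX L v) := by
  rw [isWeakDeriv_iff] at h ⊢
  intro φ hφ
  have h1 := h _ (hφ.mul_left contDiff_id)
  have e : deriv (fun x => id x * φ x) = fun x => φ x + x * deriv φ x := by
    funext x
    have := ((hasDerivAt_id x).fun_mul (hφ.smooth.differentiable_infty x).hasDerivAt).deriv
    simpa using this
  have cd : Continuous (deriv φ) := hφ.continuous_deriv
  rw [e, toL2_add hφ.smooth.continuous (continuous_id'.fun_mul cd), inner_add_right] at h1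
  simp only [id] at h1
  rw [inner_mulX_left, mulX_toL2 cd, inner_add_left, inner_mulX_left,
    mulX_toL2 hφ.smooth.continuous]
  linarith

/-! ### The weighted space -/

theorem xvol_le (L : ℝ) : xvol L ≤ ENNReal.ofReal L • vol L := by
  rw [← withDensity_const]
  refine withDensity_mono ?_
  exact (ae_restrict_mem measurableSet_Ioo).mono fun x hx => ENNReal.ofReal_le_ofReal hx.2.le

theorem xvol_ac (L : ℝ) : xvol L ≪ vol L := withDensity_absolutelyContinuous _ _

theorem vol_ac (L : ℝ) : vol L ≪ xvol L := by
  refine withDensity_absolutelyContinuous' (by fun_prop) ?_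
  exact (ae_restrict_mem measurableSet_Ioo).mono fun x hx => by simpa using hx.1

theorem memLp_xvol {f : ℝ → ℝ} (hf : MemLp f 2 (vol L)) : MemLp f 2 (xvol L) :=
  hf.of_measure_le_smul ENNReal.ofReal_ne_top (xvol_le L)

theorem inner_L2x (u v : L2x L) : inner ℝ u v = ∫ x in Ioo 0 L, x * (u x * v x) := by
  rw [L2.inner_def, integral_withDensity_eq_integral_toReal_smul (by fun_prop)
    (Filter.Eventually.of_forall fun x => ENNReal.ofReal_lt_top)]
  refine integral_congr_ae ((ae_restrict_mem measurableSet_Ioo).mono fun x hx => ?_)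
  simp [ENNReal.toReal_ofReal hx.1.le, mul_comm]

/-- The embedding of `L²(0, L)` into the weighted space. -/
def embₗ (L : ℝ) : L2 L →ₗ[ℝ] L2x L where
  toFun u := (memLp_xvol (Lp.memLp u)).toLp
  map_add' u v := by
    refine Lp.ext ?_
    filter_upwards [(memLp_xvol (Lp.memLp u)).coeFn_toLp, (memLp_xvol (Lp.memLp v)).coeFn_toLp,
      (memLp_xvol (Lp.memLp (u + v))).coeFn_toLp, (xvol_ac L).ae_eq (Lp.coeFn_add u v),
      Lp.coeFn_add (memLp_xvol (Lp.memLp u)).toLp (memLp_xvol (Lp.memLp v)).toLp]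
      with x h1 h2 h3 h4 h5
    rw [h3, h5, Pi.add_apply, h1, h2, h4, Pi.add_apply]
  map_smul' c u := by
    refine Lp.ext ?_
    filter_upwards [(memLp_xvol (Lp.memLp u)).coeFn_toLp,
      (memLp_xvol (Lp.memLp (c • u))).coeFn_toLp, (xvol_ac L).ae_eq (Lp.coeFn_smul c u),
      Lp.coeFn_smul c (memLp_xvol (Lp.memLp u)).toLp] with x h1 h2 h3 h4
    rw [h2, RingHom.id_apply, h4, Pi.smul_apply, h1, h3, Pi.smul_apply]

theorem embₗ_coe (u : L2 L) : embₗ L u =ᵐ[vol L] u :=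
  (vol_ac L).ae_eq (memLp_xvol (Lp.memLp u)).coeFn_toLp

theorem inner_embₗ (u v : L2 L) : inner ℝ (embₗ L u) (embₗ L v) = inner ℝ (mulX L u) v := by
  rw [inner_L2x, inner_eq_integral]
  refine integral_congr_ae ?_
  filter_upwards [embₗ_coe u, embₗ_coe v, mulX_coe u] with x h1 h2 h3
  rw [h1, h2, h3, mul_assoc]

/-- The continuous embedding of `L²(0, L)` into the weighted space. -/
def emb (L : ℝ) : L2 L →L[ℝ] L2x L :=
  (embₗ L).mkContinuous √|L| fun u => by
    refine abs_le_of_sq_le_sq' ?_ (by positivity) |>.2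
    rw [mul_pow, Real.sq_sqrt (abs_nonneg L), ← real_inner_self_eq_norm_sq, inner_embₗ]
    calc _ ≤ ‖mulX L u‖ * ‖u‖ := real_inner_le_norm _ _
      _ ≤ |L| * ‖u‖ * ‖u‖ := mul_le_mul_of_nonneg_right (norm_mulX_le u) (norm_nonneg _)
      _ = _ := by ring

theorem emb_coe (u : L2 L) : emb L u =ᵐ[vol L] u := embₗ_coe u

theorem inner_emb (u v : L2 L) : inner ℝ (emb L u) (emb L v) = inner ℝ (mulX L u) v :=
  inner_embₗ u v

theorem L2x_ext {u v : L2x L} (h : u =ᵐ[vol L] v) : u = v := Lp.ext ((xvol_ac L).ae_eq h)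

theorem inner_emb_right (u : L2x L) (v : L2 L) :
    inner ℝ u (emb L v) = ∫ x in Ioo 0 L, u x * (x * v x) := by
  rw [inner_L2x]
  refine integral_congr_ae ?_
  filter_upwards [emb_coe v] with x h1
  rw [h1]; ring

/-! ### Multiplication by `x` on `H²` and `H²₀` -/

/-- Multiplication by `x` on `H²(0, L)`. -/
def H2.mulX (L : ℝ) : H2 L →L[ℝ] H2 L :=
  (((PiLp.continuousLinearEquiv 2 ℝ fun _ : Fin 3 => L2 L).symm :
      (Fin 3 → L2 L) →L[ℝ] PiLp 2 fun _ : Fin 3 => L2 L).comp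
    (ContinuousLinearMap.pi ![(Kawahara.mulX L).comp (DL L 0),
      DL L 0 + (Kawahara.mulX L).comp (DL L 1),
      (2 : ℝ) • DL L 1 + (Kawahara.mulX L).comp (DL L 2)])).codRestrict (H2 L) fun u => by
    refine ⟨(isWeakDeriv_zero_one u).mulX, ?_⟩
    have := (isWeakDeriv_zero_one u).add (isWeakDeriv_one_two u).mulX
    rw [← add_assoc, ← two_smul ℝ] at this
    exact this

@[simp] theorem H2.D_zero_mulX (u : H2 L) : D 0 (mulX L u) = Kawahara.mulX L (D 0 u) := rfl

theorem mulX_mem_H20 (hL : 0 ≤ L) {u : H2 L} (hu : u ∈ H20 L) : H2.mulX L u ∈ H20 L := by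
  refine H20_induction (p := fun u => H2.mulX L u ∈ H20 L) hL ?_ ?_ hu
  · exact (Submodule.isClosed_topologicalClosure _).preimage (H2.mulX L).continuous
  · intro φ u hφ h _ _
    refine testSubmodule_le L ⟨_, hφ.mul_left contDiff_id, ?_⟩
    rw [H2.D_zero_mulX, h, mulX_toL2 hφ.smooth.continuous]; rfl

/-- Multiplication by `x` on `H²₀(0, L)`. -/
def H20.mulX (hL : 0 ≤ L) : H20 L →L[ℝ] H20 L :=
  ((H2.mulX L).comp (H20 L).subtypeL).codRestrict (H20 L) fun u => mulX_mem_H20 hL u.2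

end

end Kawahara

/-! ### Weighted identities, Poincaré and Hardy inequalities on `H²₀`. -/

namespace Kawahara

noncomputable section

variable {L : ℝ}

/-- The inner product pulled back along `P` is coercive, so Lax–Milgram applies. -/
theorem exists_inner_map_eq {V W : Type*} [NormedAddCommGroup V] [InnerProductSpace ℝ V]
    [CompleteSpace V] [NormedAddCommGroup W] [InnerProductSpace ℝ W] {c : ℝ} (hc : 0 < c)
    (P : V →L[ℝ] W) (hP : ∀ v, ‖v‖ ^ 2 ≤ c * ‖P v‖ ^ 2) (m : V →L[ℝ] ℝ) :
    ∃ w, ∀ v, inner ℝ (P w) (P v) = m v := by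
  let B : V →L[ℝ] V →L[ℝ] ℝ := (innerSL ℝ).bilinearComp P P
  have hB : IsCoercive B := by
    refine ⟨c⁻¹, by positivity, fun u => ?_⟩
    have e : B u u = ‖P u‖ ^ 2 := real_inner_self_eq_norm_sq _
    rw [e, mul_assoc, inv_mul_le_iff₀ hc, ← sq]
    exact hP u
  obtain ⟨w, hw⟩ := hB.continuousLinearEquivOfBilin.surjective ((InnerProductSpace.toDual ℝ V).symm m)
  refine ⟨w, fun v => ?_⟩
  have := hB.continuousLinearEquivOfBilin_apply w v
  rw [hw, InnerProductSpace.toDual_symm_apply] at this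
  exact this.symm

/-! ### Identities for test functions -/

theorem deriv_id_mul {f : ℝ → ℝ} (hf : ContDiff ℝ ∞ f) :
    deriv (fun x => x * f x) = fun x => f x + x * deriv f x := by
  funext x
  have := ((hasDerivAt_id x).fun_mul (hf.differentiable_infty x).hasDerivAt).deriv
  simpa using this

theorem integral_mulX_deriv_test {φ : ℝ → ℝ} (hL : 0 ≤ L) (hφ : IsTest L φ) :
    2 * ∫ x in Ioo 0 L, deriv φ x * (x * φ x) = - ∫ x in Ioo 0 L, φ x * φ x := by
  have h := integral_test_mul_deriv hL hφ (g := fun x => x * φ x) (contDiff_id.mul hφ.smooth)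
  simp only [deriv_id_mul hφ.smooth] at h
  have c1 := hφ.smooth.continuous
  have c2 := hφ.continuous_deriv
  simp only [mul_add] at h
  rw [integral_add (Continuous.integrable_vol (by fun_prop) L)
    (Continuous.integrable_vol (by fun_prop) L)] at h
  have e2 : ∀ x, φ x * (x * deriv φ x) = deriv φ x * (x * φ x) := fun x => by ring
  simp only [e2] at h
  linarith

/-- Since `η` vanishes near `0`, the quotient `η / x` is smooth there as well. -/
theorem IsTest.exists_div {η : ℝ → ℝ} (hη : IsTest L η) :
    ∃ ζ, IsTest L ζ ∧ η = fun x => x * ζ x := by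
  have h0 : (0 : ℝ) ∉ tsupport η := fun h => lt_irrefl _ (hη.supp h).1
  have hs : tsupport (fun x => x⁻¹ * η x) ⊆ tsupport η := tsupport_mul_subset_right
  refine ⟨fun x => x⁻¹ * η x, ⟨?_, hη.compact.mul_left, hs.trans hη.supp⟩, ?_⟩
  · rw [contDiff_iff_contDiffAt]
    intro x
    rcases eq_or_ne x 0 with rfl | hx
    · have : (fun x => x⁻¹ * η x) =ᶠ[nhds 0] fun _ => 0 := by
        filter_upwards [(isClosed_tsupport η).isOpen_compl.mem_nhds h0] with y hy
        rw [image_eq_zero_of_notMem_tsupport hy, mul_zero]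
      exact contDiffAt_const.congr_of_eventuallyEq this
    · exact (contDiffAt_inv ℝ hx).mul hη.smooth.contDiffAt
  · funext x
    rcases eq_or_ne x 0 with rfl | hx
    · simp [hη.at_zero]
    · field_simp

theorem norm_sq_toL2 {f : ℝ → ℝ} (hf : Continuous f) :
    ‖toL2 L f‖ ^ 2 = ∫ x in Ioo 0 L, f x * f x := by
  rw [← real_inner_self_eq_norm_sq, inner_toL2_toL2 hf hf]

/-- Expand `(x ζ)' = ζ + x ζ'`; the second term contributes minus half the square. Cauchy–Schwarz
then bounds `ζ` by twice `(x ζ)'`, which lets the identity pass to limits. -/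
theorem IsTest.hardy {ζ : ℝ → ℝ} (hL : 0 ≤ L) (hζ : IsTest L ζ) :
    inner ℝ (toL2 L (_root_.deriv fun x => x * ζ x)) (toL2 L ζ) = 1 / 2 * ‖toL2 L ζ‖ ^ 2 := by
  have c1 := hζ.smooth.continuous
  have c2 := hζ.continuous_deriv
  rw [deriv_id_mul hζ.smooth, inner_toL2_toL2 (by fun_prop) c1, norm_sq_toL2 c1]
  simp only [add_mul]
  rw [integral_add (Continuous.integrable_vol (by fun_prop) L)
    (Continuous.integrable_vol (by fun_prop) L)]
  have h := integral_mulX_deriv_test hL hζ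
  have e2 : ∀ x, x * _root_.deriv ζ x * ζ x = _root_.deriv ζ x * (x * ζ x) := fun x => by ring
  simp only [e2]
  linarith

/-! ### Identities on `H²₀` -/

/-- `ContinuousLinearMap.le_opNorm`, with instances found by unification. -/
theorem norm_apply_le_of_implicit {E : Type*} {_ : NormedAddCommGroup E} {_ : NormedSpace ℝ E}
    (m : E →L[ℝ] ℝ) (u : E) : ‖m u‖ ≤ ‖m‖ * ‖u‖ := m.le_opNorm u

/-- `H²₀(0, L)` as a Hilbert space of its own. -/
def V (L : ℝ) : Type := H20 L

namespace V

instance : NormedAddCommGroup (V L) := inferInstanceAs (NormedAddCommGroup (H20 L))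
instance : InnerProductSpace ℝ (V L) := inferInstanceAs (InnerProductSpace ℝ (H20 L))
instance : CompleteSpace (V L) := inferInstanceAs (CompleteSpace (H20 L))

/-- The inclusion of `H²₀` into `H²`. -/
def toH2 (L : ℝ) : V L →L[ℝ] H2 L where
  toFun u := Subtype.val (p := (· ∈ H20 L)) u
  map_add' _ _ := rfl
  map_smul' _ _ := rfl
  cont := continuous_subtype_val

/-- The identification of `V` with `H²₀`. -/
def toH20 (L : ℝ) : V L →L[ℝ] H20 L where
  toFun u := u
  map_add' _ _ := rfl
  map_smul' _ _ := rfl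
  cont := continuous_id

/-- The identification of `H²₀` with `V`. -/
def ofH20 (L : ℝ) : H20 L →L[ℝ] V L where
  toFun u := u
  map_add' _ _ := rfl
  map_smul' _ _ := rfl
  cont := continuous_id

theorem coe_toH20 (u : V L) : (toH20 L u : H2 L) = toH2 L u := rfl
theorem toH2_mem (u : V L) : toH2 L u ∈ H20 L := (toH20 L u).2
theorem norm_toH2 (u : V L) : ‖toH2 L u‖ = ‖u‖ := rfl

/-- The weak derivatives of an element of `H²₀`. -/
def D (k : Fin 3) : V L →L[ℝ] L2 L := (H2.DL L k).comp (toH2 L)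

theorem D_eq (k : Fin 3) (u : V L) : D k u = H2.D k (toH2 L u) := rfl

/-- The restriction to `V` of an element of `H⁻²(0, L)`. -/
def ofHm2 (f : Hm2 L) : V L →L[ℝ] ℝ := f.comp (toH20 L)

theorem norm_ofHm2_le (f : Hm2 L) : ‖ofHm2 f‖ ≤ ‖f‖ :=
  (ofHm2 f).opNorm_le_bound (norm_nonneg f)
    fun u => norm_apply_le_of_implicit f (toH20 L u)

/-- Multiplication by `x` on `H²₀(0, L)`. -/
def mulX (hL : 0 ≤ L) : V L →L[ℝ] V L where
  toFun u := H20.mulX hL u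
  map_add' := (H20.mulX hL).map_add
  map_smul' := (H20.mulX hL).map_smul
  cont := (H20.mulX hL).continuous

theorem toH2_mulX (hL : 0 ≤ L) (u : V L) : toH2 L (mulX hL u) = H2.mulX L (toH2 L u) := rfl

variable (u : V L)

/-- All boundary terms are killed on the side of `u`, so `h` is unconstrained at the ends: this is
how the boundary conditions of `u` are used without traces. -/
theorem inner_D1_toL2 (hL : 0 ≤ L) {h : ℝ → ℝ} (hh : ContDiff ℝ ∞ h) :
    inner ℝ (D 1 u) (toL2 L h) = - inner ℝ (D 0 u) (toL2 L (deriv h)) := by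
  refine H20_induction (p := fun u => inner ℝ (H2.D 1 u) (toL2 L h)
    = - inner ℝ (H2.D 0 u) (toL2 L (deriv h))) hL (isClosed_eq (by fun_prop) (by fun_prop)) ?_ (toH2_mem u)
  intro φ u hφ h0 h1 _
  rw [h0, h1, inner_toL2_toL2 hφ.continuous_deriv hh.continuous,
    inner_toL2_toL2 hφ.smooth.continuous hh.deriv_infty.continuous]
  exact integral_test_mul_deriv hL hφ hh

theorem inner_D2_toL2 (hL : 0 ≤ L) {h : ℝ → ℝ} (hh : ContDiff ℝ ∞ h) :
    inner ℝ (D 2 u) (toL2 L h) = - inner ℝ (D 1 u) (toL2 L (deriv h)) := by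
  refine H20_induction (p := fun u => inner ℝ (H2.D 2 u) (toL2 L h)
    = - inner ℝ (H2.D 1 u) (toL2 L (deriv h))) hL (isClosed_eq (by fun_prop) (by fun_prop)) ?_ (toH2_mem u)
  intro φ u hφ _ h1 h2
  rw [h1, h2, inner_toL2_toL2 hφ.deriv.continuous_deriv hh.continuous,
    inner_toL2_toL2 hφ.continuous_deriv hh.deriv_infty.continuous]
  exact integral_test_mul_deriv hL hφ.deriv hh

theorem two_inner_D1_mulX (hL : 0 ≤ L) :
    2 * inner ℝ (D 1 u) (Kawahara.mulX L (D 0 u))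
      = - ‖D 0 u‖ ^ 2 := by
  refine H20_induction (p := fun u => 2 * inner ℝ (H2.D 1 u) (Kawahara.mulX L (H2.D 0 u))
      = - ‖H2.D 0 u‖ ^ 2) hL (isClosed_eq (by fun_prop) (by fun_prop)) ?_ (toH2_mem u)
  intro φ u hφ h0 h1 _
  have c := hφ.smooth.continuous
  rw [h0, h1, mulX_toL2 c, inner_toL2_toL2 hφ.continuous_deriv (by fun_prop),
    norm_sq_toL2 c, integral_mulX_deriv_test hL hφ]

theorem two_inner_D2_mulX (hL : 0 ≤ L) :
    2 * inner ℝ (D 2 u) (Kawahara.mulX L (D 1 u))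
      = - ‖D 1 u‖ ^ 2 := by
  refine H20_induction (p := fun u => 2 * inner ℝ (H2.D 2 u) (Kawahara.mulX L (H2.D 1 u))
      = - ‖H2.D 1 u‖ ^ 2) hL (isClosed_eq (by fun_prop) (by fun_prop)) ?_ (toH2_mem u)
  intro φ u hφ _ h1 h2
  have c := hφ.continuous_deriv
  rw [h1, h2, mulX_toL2 c, inner_toL2_toL2 hφ.deriv.continuous_deriv (by fun_prop),
    norm_sq_toL2 c, integral_mulX_deriv_test hL hφ.deriv]

theorem inner_D2_D0 (hL : 0 ≤ L) :
    inner ℝ (D 2 u) (D 0 u) = - ‖D 1 u‖ ^ 2 := by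
  refine H20_induction (p := fun u => inner ℝ (H2.D 2 u) (H2.D 0 u) = - ‖H2.D 1 u‖ ^ 2) hL
    (isClosed_eq (by fun_prop) (by fun_prop)) ?_ (toH2_mem u)
  intro φ u hφ h0 h1 h2
  rw [h0, h1, h2, inner_toL2_toL2 hφ.deriv.continuous_deriv hφ.smooth.continuous,
    norm_sq_toL2 hφ.continuous_deriv]
  exact integral_test_mul_deriv hL hφ.deriv hφ.smooth

/-- Cauchy–Schwarz and `|x| ≤ L` turn the weighted identities into Poincaré inequalities. -/
theorem _root_.Kawahara.norm_le_of_two_inner_mulX (hL : 0 ≤ L) {a b : L2 L}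
    (h : 2 * inner ℝ b (Kawahara.mulX L a) = - ‖a‖ ^ 2) : ‖a‖ ≤ 2 * L * ‖b‖ := by
  have h1 := abs_real_inner_le_norm b (Kawahara.mulX L a)
  have h2 := norm_mulX_le (L := L) a
  rw [abs_of_nonneg hL] at h2
  have h3 := neg_le_abs (inner ℝ b (Kawahara.mulX L a))
  have h4 : ‖b‖ * ‖Kawahara.mulX L a‖ ≤ ‖b‖ * (L * ‖a‖) :=
    mul_le_mul_of_nonneg_left h2 (norm_nonneg _)
  rcases (norm_nonneg a).eq_or_lt with h0 | h0
  · rw [← h0]; positivity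
  · refine le_of_mul_le_mul_right ?_ h0
    nlinarith

theorem norm_D0_le (hL : 0 ≤ L) : ‖D 0 u‖ ≤ 2 * L * ‖D 1 u‖ :=
  norm_le_of_two_inner_mulX hL (two_inner_D1_mulX u hL)

theorem norm_D1_le (hL : 0 ≤ L) : ‖D 1 u‖ ≤ 2 * L * ‖D 2 u‖ :=
  norm_le_of_two_inner_mulX hL (two_inner_D2_mulX u hL)

/-- The constant in the Poincaré inequality `poincare`. -/
def pconst (L : ℝ) : ℝ := 16 * L ^ 4 + 4 * L ^ 2 + 1

theorem pconst_pos (L : ℝ) : 0 < pconst L := by unfold pconst; positivity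

theorem poincare (hL : 0 ≤ L) : ‖u‖ ^ 2 ≤ pconst L * ‖D 2 u‖ ^ 2 := by
  have h0 := norm_D0_le u hL
  have h1 := norm_D1_le u hL
  have h1' := pow_le_pow_left₀ (norm_nonneg _) h1 2
  have h0' := pow_le_pow_left₀ (norm_nonneg _) h0 2
  have h2 : ‖u‖ ^ 2 = ‖D 0 u‖ ^ 2 + ‖D 1 u‖ ^ 2 + ‖D 2 u‖ ^ 2 := H2.norm_sq (toH2 L u)
  rw [h2, pconst]
  rw [mul_pow] at h0' h1'
  have := mul_le_mul_of_nonneg_left h1' (by positivity : 0 ≤ (2 * L) ^ 2)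
  nlinarith

/-- Hardy's inequality: `u_x / x` is in `L²`. -/
theorem exists_hardy (hL : 0 ≤ L) : ∃ Y : L2 L, Kawahara.mulX L Y = D 1 u ∧
    inner ℝ (D 2 u) Y = 1 / 2 * ‖Y‖ ^ 2 := by
  have key : ∀ w ∈ testSubmodule L, ∃ Y : L2 L, Kawahara.mulX L Y = H2.D 1 w ∧
      inner ℝ (H2.D 2 w) Y = 1 / 2 * ‖Y‖ ^ 2 := by
    rintro w ⟨φ, hφ, h0⟩
    obtain ⟨ζ, hζ, hζ'⟩ := hφ.deriv.exists_div
    refine ⟨toL2 L ζ, ?_, ?_⟩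
    · rw [mulX_toL2 hζ.smooth.continuous, H2.D1_eq hL hφ.smooth h0, hζ']
    · rw [H2.D2_eq hL hφ.smooth h0, hζ', hζ.hardy hL]
  have hu : toH2 L u ∈ closure (testSubmodule L : Set (H2 L)) := by
    have : toH2 L u ∈ (testSubmodule L).topologicalClosure := H20_eq L ▸ toH2_mem u
    exact this
  obtain ⟨w, hw, hwu⟩ := mem_closure_iff_seq_limit.1 hu
  choose Y hY hY' using fun n => key (w n) (hw n)
  have hcauchy : CauchySeq Y := by
    have hc := (((H2.continuous_D 2).tendsto _).comp hwu).cauchySeq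
    rw [Metric.cauchySeq_iff] at hc ⊢
    intro ε hε
    obtain ⟨N, hN⟩ := hc (ε / 2) (by positivity)
    refine ⟨N, fun m hm n hn => ?_⟩
    obtain ⟨Z, hZ, hZ'⟩ := key _ (sub_mem (hw m) (hw n))
    -- Quotients by `x` are unique, so `Y m - Y n` is the quotient attached to `w m - w n`. The
    -- identity bounds it by `2 ‖D 2 (w m - w n)‖`, hence `Y` is Cauchy.
    have e : Z = Y m - Y n := mulX_injective (by rw [hZ, map_sub, hY, hY, H2.D_sub])
    have h1 := hN m hm n hn
    rw [dist_eq_norm] at h1 ⊢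
    simp only [Function.comp, ← H2.D_sub] at h1
    rw [← e]
    have h2 := real_inner_le_norm (H2.D 2 (w m - w n)) Z
    rcases (norm_nonneg Z).eq_or_lt with h0 | h0
    · rwa [← h0]
    · have : ‖Z‖ ≤ 2 * ‖H2.D 2 (w m - w n)‖ := by
        refine le_of_mul_le_mul_right ?_ h0
        nlinarith
      linarith
  obtain ⟨Z, hZ⟩ := cauchySeq_tendsto_of_complete hcauchy
  refine ⟨Z, tendsto_nhds_unique ((((Kawahara.mulX L).continuous.tendsto _).comp hZ).congr hY)
    (((H2.continuous_D 1).tendsto _).comp hwu), ?_⟩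
  refine tendsto_nhds_unique (((((H2.continuous_D 2).tendsto _).comp hwu).inner hZ).congr hY')
    ((hZ.norm.pow 2).const_mul _)

/-- Riesz representation with respect to the inner product `∫ u_xx v_xx` of `H²₀`. -/
theorem exists_inner_D2_eq (hL : 0 ≤ L) (m : V L →L[ℝ] ℝ) :
    ∃ w : V L, ∀ v : V L, inner ℝ (D 2 w) (D 2 v) = m v :=
  exists_inner_map_eq (pconst_pos L) (D 2) (fun v => poincare v hL) m

end V

end

end Kawahara

/-! ### Smooth elements of `H²₀` and the bilinear form. -/

namespace Kawahara

noncomputable section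

variable {L : ℝ}

theorem contDiff_self : ContDiff ℝ ∞ (fun x : ℝ => x) := contDiff_id

theorem inner_toL2_zero_fun (u : L2 L) : inner ℝ u (toL2 L fun _ => 0) = 0 := by
  rw [inner_toL2 u continuous_const]; simp

/-- Orthogonality to second derivatives of test functions says `r'' = 0` in the weak sense, so `r`
is affine; orthogonality to `1` and `x` then gives `r ⊥ r`. -/
theorem eq_zero_of_orthogonal (hL : 0 < L) (r : L2 L)
    (h : ∀ φ, IsTest L φ → inner ℝ r (toL2 L (deriv (deriv φ))) = 0)
    (h0 : inner ℝ r (toL2 L fun _ => 1) = 0) (h1 : inner ℝ r (toL2 L fun x => x) = 0) : r = 0 := by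
  obtain ⟨θ₀, θ₁, t0, t1, e00, e01, e10, e11⟩ := exists_test_moments hL
  have c0 := t0.smooth.continuous
  have c1 := t1.smooth.continuous
  set A := inner ℝ r (toL2 L θ₀)
  set B := inner ℝ r (toL2 L θ₁)
  have hr : r = toL2 L (fun x => A * 1 + B * x) := by
    refine eq_of_inner_toL2_test fun θ hθ => ?_
    have c := hθ.smooth.continuous
    obtain ⟨m0, hm0⟩ : ∃ m, m = ∫ x in Ioo 0 L, θ x := ⟨_, rfl⟩
    obtain ⟨m1, hm1⟩ : ∃ m, m = ∫ x in Ioo 0 L, x * θ x := ⟨_, rfl⟩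
    -- Removing the two moments of `θ` leaves a second derivative, invisible to `r`; so `r` sees `θ`
    -- only through `m0` and `m1`, with coefficients `A` and `B`.
    obtain ⟨φ, hφ, hφ'⟩ := ((hθ.sub (t0.const_mul m0)).sub
      (t1.const_mul m1)).exists_second_primitive hL (by
        rw [integral_sub (Continuous.integrable_vol (by fun_prop) L)
          (Continuous.integrable_vol (by fun_prop) L),
          integral_sub (Continuous.integrable_vol (by fun_prop) L)
          (Continuous.integrable_vol (by fun_prop) L), integral_const_mul, integral_const_mul,
          e00, e10, ← hm0]; ring) (by
        have : ∀ x, x * (θ x - m0 * θ₀ x - m1 * θ₁ x)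
          = x * θ x - m0 * (x * θ₀ x) - m1 * (x * θ₁ x) := fun x => by ring
        simp only [this]
        rw [integral_sub (Continuous.integrable_vol (by fun_prop) L)
          (Continuous.integrable_vol (by fun_prop) L),
          integral_sub (Continuous.integrable_vol (by fun_prop) L)
          (Continuous.integrable_vol (by fun_prop) L), integral_const_mul, integral_const_mul,
          e01, e11, ← hm1]; ring)
    have h2 := h φ hφ
    rw [hφ', toL2_sub (by fun_prop) (by fun_prop), toL2_sub (by fun_prop) (by fun_prop),
      toL2_const_mul _ c0, toL2_const_mul _ c1, inner_sub_right, inner_sub_right,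
      inner_smul_right, inner_smul_right] at h2
    rw [toL2_add (by fun_prop) (by fun_prop), toL2_const_mul _ (by fun_prop),
      toL2_const_mul _ (by fun_prop), inner_add_left, real_inner_smul_left, real_inner_smul_left,
      inner_toL2_toL2 (by fun_prop) c, inner_toL2_toL2 (by fun_prop) c]
    simp only [one_mul, ← hm0, ← hm1]
    linarith
  have : inner ℝ r r = 0 := by
    nth_rw 2 [hr]
    rw [toL2_add (by fun_prop) (by fun_prop), toL2_const_mul _ (by fun_prop),
      toL2_const_mul _ (by fun_prop), inner_add_right, inner_smul_right, inner_smul_right, h0, h1]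
    ring
  exact inner_self_eq_zero.1 this

namespace V

variable (u : V L)

theorem inner_D2_one (hL : 0 ≤ L) : inner ℝ (D 2 u) (toL2 L fun _ => 1) = 0 := by
  rw [inner_D2_toL2 u hL contDiff_const, deriv_const', inner_toL2_zero_fun, neg_zero]

theorem inner_D2_id (hL : 0 ≤ L) : inner ℝ (D 2 u) (toL2 L fun x => x) = 0 := by
  rw [inner_D2_toL2 u hL contDiff_self, deriv_id'', inner_D1_toL2 u hL contDiff_const,
    deriv_const', inner_toL2_zero_fun, neg_zero, neg_zero]

theorem D1_eq (hL : 0 ≤ L) {u : V L} {f : ℝ → ℝ} (hf : ContDiff ℝ ∞ f) (h : D 0 u = toL2 L f) :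
    D 1 u = toL2 L (deriv f) := H2.D1_eq hL hf h

theorem D2_eq (hL : 0 ≤ L) {u : V L} {f : ℝ → ℝ} (hf : ContDiff ℝ ∞ f) (h : D 0 u = toL2 L f) :
    D 2 u = toL2 L (deriv (deriv f)) := H2.D2_eq hL hf h

/-- A smooth function vanishing to first order at both ends belongs to `H²₀`. -/
theorem exists_of_smooth (hL : 0 < L) {v : ℝ → ℝ} (hv : ContDiff ℝ ∞ v) (h0 : v 0 = 0)
    (h0' : deriv v 0 = 0) (hl : v L = 0) (hl' : deriv v L = 0) : ∃ u : V L, D 0 u = toL2 L v := by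
  have hv1 := hv.deriv_infty
  have hv2 := hv1.deriv_infty
  -- The candidate is the projection of `v''` on second derivatives of `H²₀`. The residual is
  -- orthogonal to `1` and `x` because of the boundary values of `v`, so it vanishes.
  obtain ⟨u, hu⟩ := exists_inner_D2_eq hL.le
    ((innerSL ℝ (toL2 L (deriv (deriv v)))).comp (D 2))
  simp only [ContinuousLinearMap.comp_apply, innerSL_apply_apply] at hu
  have e2 : toL2 L (deriv (deriv v)) = D 2 u := by
    rw [← sub_eq_zero]
    refine eq_zero_of_orthogonal hL _ (fun φ hφ => ?_) ?_ ?_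
    · obtain ⟨w, hw⟩ : ∃ w : V L, D 0 w = toL2 L φ :=
        ⟨ofH20 L ⟨H2.ofSmooth hL.le hφ.smooth, testSubmodule_le L ⟨φ, hφ, rfl⟩⟩, rfl⟩
      rw [← D2_eq hL.le hφ.smooth hw, inner_sub_left, hu w, sub_self]
    · rw [inner_sub_left, inner_D2_one u hL.le, inner_toL2_toL2 hv2.continuous (by fun_prop),
        integral_deriv_mul hL.le hv1 contDiff_const, h0', hl']
      simp
    · rw [inner_sub_left, inner_D2_id u hL.le, inner_toL2_toL2 hv2.continuous (by fun_prop),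
        integral_deriv_mul hL.le hv1 contDiff_self, h0', hl', deriv_id'',
        integral_deriv_mul hL.le hv contDiff_const, h0, hl]
      simp
  -- Test against `θ` by integrating by parts with its primitive, which need not vanish at `L`: the
  -- end values of `v'`, and below those of `v`, absorb this.
  have e1 : D 1 u = toL2 L (deriv v) := by
    refine eq_of_inner_toL2_test fun θ hθ => ?_
    have hz := contDiff_primitive hθ.smooth
    have hz' := deriv_primitive hθ.smooth.continuous
    have := inner_D2_toL2 u hL.le hz
    rw [hz', ← e2, inner_toL2_toL2 hv2.continuous hz.continuous,
      integral_deriv_mul hL.le hv1 hz, h0', hl', hz'] at this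
    rw [inner_toL2_toL2 hv1.continuous hθ.smooth.continuous]
    linarith
  refine ⟨u, eq_of_inner_toL2_test fun θ hθ => ?_⟩
  have hz := contDiff_primitive hθ.smooth
  have hz' := deriv_primitive hθ.smooth.continuous
  have := inner_D1_toL2 u hL.le hz
  rw [hz', e1, inner_toL2_toL2 hv1.continuous hz.continuous,
    integral_deriv_mul hL.le hv hz, h0, hl, hz'] at this
  rw [inner_toL2_toL2 hv.continuous hθ.smooth.continuous]
  linarith

/-- The boundary conditions satisfied by the smooth elements of `H²₀`. -/
theorem boundary (hL : 0 < L) {v : ℝ → ℝ} (hv : ContDiff ℝ ∞ v) (h : D 0 u = toL2 L v) :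
    v 0 = 0 ∧ deriv v 0 = 0 ∧ v L = 0 ∧ deriv v L = 0 := by
  have hv1 := hv.deriv_infty
  -- Integration by parts without boundary terms against every smooth `g` forces `f L * g L = f 0 *
  -- g 0`; `g = x` and `g = 1` isolate the two values.
  have k : ∀ {f : ℝ → ℝ}, ContDiff ℝ ∞ f → (∀ g, ContDiff ℝ ∞ g →
      inner ℝ (toL2 L (deriv f)) (toL2 L g) = - inner ℝ (toL2 L f) (toL2 L (deriv g))) →
      f 0 = 0 ∧ f L = 0 := by
    intro f hf H
    have K : ∀ g, ContDiff ℝ ∞ g → f L * g L - f 0 * g 0 = 0 := fun g hg => by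
      have := H g hg
      rw [inner_toL2_toL2 hf.deriv_infty.continuous hg.continuous,
        inner_toL2_toL2 hf.continuous hg.deriv_infty.continuous,
        integral_deriv_mul hL.le hf hg] at this
      linarith
    have a := K (fun x => x) contDiff_self
    have b := K (fun _ => 1) contDiff_const
    simp only [mul_zero, sub_zero, mul_eq_zero, hL.ne', or_false] at a
    rw [a] at b
    exact ⟨by linarith, a⟩
  have e1 := D1_eq hL.le hv h
  obtain ⟨a, b⟩ := k hv fun g hg => by rw [← e1, ← h]; exact inner_D1_toL2 u hL.le hg
  obtain ⟨c, d⟩ := k hv1 fun g hg => by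
    rw [← D2_eq hL.le hv h, ← e1]; exact inner_D2_toL2 u hL.le hg
  exact ⟨a, c, b, d⟩

end V

/-! ### The bilinear form -/

/-- The pairs `(v, x v_xxx)` for `v ∈ H²₀` smooth up to the boundary. -/
def coreGraph (L : ℝ) : Submodule ℝ (V L × L2 L) where
  carrier := {p | ∃ v : ℝ → ℝ, ContDiff ℝ ∞ v ∧ V.D 0 p.1 = toL2 L v ∧
    p.2 = toL2 L fun x => x * deriv (deriv (deriv v)) x}
  add_mem' := by
    rintro p q ⟨v, hv, h1, h2⟩ ⟨w, hw, h3, h4⟩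
    have hv3 := hv.deriv_infty.deriv_infty.deriv_infty.continuous
    have hw3 := hw.deriv_infty.deriv_infty.deriv_infty.continuous
    have d : ∀ {f g : ℝ → ℝ}, ContDiff ℝ ∞ f → ContDiff ℝ ∞ g →
        deriv (fun x => f x + g x) = fun x => deriv f x + deriv g x := fun hf hg =>
      funext fun x => deriv_fun_add (hf.differentiable_infty x) (hg.differentiable_infty x)
    refine ⟨fun x => v x + w x, hv.add hw, ?_, ?_⟩
    · rw [Prod.fst_add, map_add, h1, h3, toL2_add hv.continuous hw.continuous]
    · rw [Prod.snd_add, h2, h4, d hv hw, d hv.deriv_infty hw.deriv_infty,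
        d hv.deriv_infty.deriv_infty hw.deriv_infty.deriv_infty,
        ← toL2_add (by fun_prop) (by fun_prop)]
      simp only [mul_add]
  zero_mem' := by
    have z : (0 : L2 L) = toL2 L fun _ => 0 := eq_toL2 continuous_const (Lp.coeFn_zero ℝ 2 (vol L))
    refine ⟨fun _ => 0, contDiff_const, by rw [Prod.fst_zero, map_zero, z], ?_⟩
    simp only [deriv_const', mul_zero, Prod.snd_zero, z]
  smul_mem' := by
    rintro c p ⟨v, hv, h1, h2⟩
    have hv3 := hv.deriv_infty.deriv_infty.deriv_infty.continuous
    have d : ∀ f : ℝ → ℝ, deriv (fun x => c * f x) = fun x => c * deriv f x := fun f =>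
      funext fun x => deriv_const_mul_field c
    refine ⟨fun x => c * v x, contDiff_const.mul hv, ?_, ?_⟩
    · rw [Prod.smul_fst, map_smul, h1, toL2_const_mul c hv.continuous]
    · rw [Prod.smul_snd, h2, d, d, d, ← toL2_const_mul c (by fun_prop)]
      simp only [mul_left_comm]

/-- The bounded part of the bilinear form of the equation, in the first variable. -/
def lowerForm (v : V L) : V L →L[ℝ] ℝ :=
  (innerSL ℝ (mulX L (V.D 0 v))).comp (V.D 1)
    - (innerSL ℝ (V.D 0 v + mulX L (V.D 1 v))).comp (V.D 2)
    + (3 : ℝ) • (innerSL ℝ (V.D 2 v)).comp (V.D 2)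

theorem lowerForm_apply (v u : V L) : lowerForm v u = inner ℝ (mulX L (V.D 0 v)) (V.D 1 u)
    - inner ℝ (V.D 0 v + mulX L (V.D 1 v)) (V.D 2 u) + 3 * inner ℝ (V.D 2 v) (V.D 2 u) := rfl

/-- The bounded part of the bilinear form of the equation, in the second variable. -/
def lowerForm' (u : V L) : V L →L[ℝ] ℝ :=
  (innerSL ℝ (V.D 1 u)).comp ((mulX L).comp (V.D 0))
    - (innerSL ℝ (V.D 2 u)).comp (V.D 0 + (mulX L).comp (V.D 1))
    + (3 : ℝ) • (innerSL ℝ (V.D 2 u)).comp (V.D 2)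

theorem lowerForm'_apply (v u : V L) : lowerForm' u v = lowerForm v u := by
  rw [lowerForm_apply, real_inner_comm, real_inner_comm (V.D 2 u), real_inner_comm (V.D 2 u)]
  rfl

/-- The quadratic form of the spatial operator. -/
def quadForm (u : V L) : ℝ :=
  5 / 2 * ‖V.D 2 u‖ ^ 2 + 3 / 2 * ‖V.D 1 u‖ ^ 2 - 1 / 2 * ‖V.D 0 u‖ ^ 2

theorem lowerForm_self (hL : 0 ≤ L) (u : V L) :
    lowerForm u u = quadForm u + 1 / 2 * ‖V.D 2 u‖ ^ 2 := by
  have h1 := V.two_inner_D1_mulX u hL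
  have h2 := V.two_inner_D2_mulX u hL
  have h3 := V.inner_D2_D0 u hL
  rw [lowerForm_apply, inner_add_left, real_inner_comm, real_inner_comm (V.D 2 u),
    real_inner_comm (V.D 2 u), real_inner_self_eq_norm_sq, quadForm]
  linarith

/-- The embedding of `H²₀` into the weighted space. -/
def V.emb (L : ℝ) : V L →L[ℝ] L2x L := (Kawahara.emb L).comp (V.D 0)

/-- Only `-1/2 |u|²` has the wrong sign. From `|u|² = -2 ∫ x u u_x`, Cauchy–Schwarz in `L²_{x dx}`
gives `|u|² ≤ |u_x|² + L ‖u‖²_{x dx}`; the first term is absorbed, the second gives the constant `L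
/ 2`. The remaining `|u_xx|²` controls the full norm by `V.poincare`. -/
theorem garding (hL : 0 < L) (u : V L) :
    (V.pconst L)⁻¹ * ‖u‖ ^ 2 ≤ quadForm u + L / 2 * ‖V.emb L u‖ ^ 2 := by
  have h0 := V.two_inner_D1_mulX u hL.le
  have h1 : inner ℝ (V.D 1 u) (mulX L (V.D 0 u)) = inner ℝ (emb L (V.D 1 u)) (V.emb L u) := by
    rw [V.emb, ContinuousLinearMap.comp_apply, Kawahara.inner_emb, inner_mulX_left]
  have h2 := abs_real_inner_le_norm (emb L (V.D 1 u)) (V.emb L u)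
  have h3 : ‖emb L (V.D 1 u)‖ ^ 2 ≤ L * ‖V.D 1 u‖ ^ 2 := by
    rw [← real_inner_self_eq_norm_sq, Kawahara.inner_emb]
    have a := real_inner_le_norm (mulX L (V.D 1 u)) (V.D 1 u)
    have b := norm_mulX_le (L := L) (V.D 1 u)
    rw [abs_of_nonneg hL.le] at b
    nlinarith [norm_nonneg (V.D 1 u)]
  have h4 := neg_le_abs (inner ℝ (emb L (V.D 1 u)) (V.emb L u))
  have h5 : ‖V.D 0 u‖ ^ 2 ≤ ‖V.D 1 u‖ ^ 2 + L * ‖V.emb L u‖ ^ 2 := by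
    have a : ‖V.D 0 u‖ ^ 2 ≤ 2 * (‖emb L (V.D 1 u)‖ * ‖V.emb L u‖) := by
      rw [h1] at h0; linarith
    have b := sq_nonneg (‖emb L (V.D 1 u)‖ - L * ‖V.emb L u‖)
    refine le_of_mul_le_mul_left ?_ hL
    nlinarith [mul_le_mul_of_nonneg_left a hL.le]
  have h6 : (V.pconst L)⁻¹ * ‖u‖ ^ 2 ≤ ‖V.D 2 u‖ ^ 2 := by
    rw [inv_mul_le_iff₀ (V.pconst_pos L)]; exact V.poincare u hL.le
  rw [quadForm]
  nlinarith [sq_nonneg ‖V.D 1 u‖, sq_nonneg ‖V.D 2 u‖]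

/-- With `s = v_xx`, `2 ∫ x s s' = L s(L)² - ∫ s²`: the weight kills the term at `0`, and the one at
`L`, where `s` is free, is nonnegative. -/
theorem inner_D2_core_ge (hL : 0 ≤ L) {p : V L × L2 L} (hp : p ∈ coreGraph L) :
    - (1 / 2 * ‖V.D 2 p.1‖ ^ 2) ≤ inner ℝ p.2 (V.D 2 p.1) := by
  obtain ⟨v, hv, h1, h2⟩ := hp
  have hs := hv.deriv_infty.deriv_infty
  rw [V.D2_eq hL hv h1, h2]
  generalize deriv (deriv v) = s at hs
  have c1 := hs.continuous
  have c2 := hs.deriv_infty.continuous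
  have hx : ContDiff ℝ ∞ (fun x => x * s x) := contDiff_id.mul hs
  rw [inner_toL2_toL2 (by fun_prop) c1, norm_sq_toL2 c1]
  have h := integral_deriv_mul hL hs hx
  rw [deriv_id_mul hs] at h
  simp only [mul_add] at h
  rw [integral_add (Continuous.integrable_vol (by fun_prop) L)
    (Continuous.integrable_vol (by fun_prop) L)] at h
  have e1 : ∀ x, deriv s x * (x * s x) = x * deriv s x * s x := fun x => by ring
  have e2 : ∀ x, s x * (x * deriv s x) = x * deriv s x * s x := fun x => by ring
  simp only [e1, e2] at h
  have : 0 ≤ s L * (L * s L) := by nlinarith [mul_self_nonneg (s L)]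
  linarith

end

end Kawahara

/-! ### The spatial form and its energy identity. -/

namespace Kawahara

noncomputable section

variable {L : ℝ}

theorem deriv_deriv_id_mul {f : ℝ → ℝ} (hf : ContDiff ℝ ∞ f) :
    deriv (deriv fun x => x * f x) = fun x => 2 * deriv f x + x * deriv (deriv f) x := by
  have h1 := hf.deriv_infty
  rw [deriv_id_mul hf]
  funext x
  rw [deriv_fun_add (hf.differentiable_infty x)
    ((contDiff_self.differentiable_infty x).fun_mul (h1.differentiable_infty x))]
  have := congrFun (deriv_id_mul h1) x
  rw [this]; ring

theorem deriv_deriv_deriv_id_mul {f : ℝ → ℝ} (hf : ContDiff ℝ ∞ f) :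
    deriv (deriv (deriv fun x => x * f x))
      = fun x => 3 * deriv (deriv f) x + x * deriv (deriv (deriv f)) x := by
  have h1 := hf.deriv_infty
  have h2 := h1.deriv_infty
  rw [deriv_deriv_id_mul hf]
  funext x
  rw [deriv_fun_add ((h1.differentiable_infty x).const_mul 2)
    ((contDiff_self.differentiable_infty x).fun_mul (h2.differentiable_infty x)), deriv_const_mul_field]
  have := congrFun (deriv_id_mul h2) x
  rw [this]; ring

/-- The form `∫ (u_x ψ - u_xx ψ' + u_xx ψ''')` with `ψ = x v`, as a functional of `u`, linear in the
pair `(v, x v_xxx)`. -/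
def form (L : ℝ) : V L × L2 L →ₗ[ℝ] (V L →L[ℝ] ℝ) where
  toFun p := lowerForm p.1 + (innerSL ℝ p.2).comp (V.D 2)
  map_add' p q := by
    ext u
    simp only [add_apply, lowerForm_apply, ContinuousLinearMap.comp_apply,
      innerSL_apply_apply, Prod.fst_add, Prod.snd_add, map_add, inner_add_left]
    ring
  map_smul' c p := by
    ext u
    simp only [add_apply, lowerForm_apply, ContinuousLinearMap.comp_apply,
      innerSL_apply_apply, Prod.smul_fst, Prod.smul_snd, map_smul, inner_add_left,
      real_inner_smul_left, RingHom.id_apply, smul_apply, smul_eq_mul]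
    ring

theorem form_apply (p : V L × L2 L) (u : V L) :
    form L p u = lowerForm p.1 u + inner ℝ p.2 (V.D 2 u) := rfl

theorem form_core_self_ge (hL : 0 < L) {p : V L × L2 L} (hp : p ∈ coreGraph L) :
    quadForm p.1 ≤ form L p p.1 := by
  rw [form_apply, lowerForm_self hL.le]
  linarith [inner_D2_core_ge hL.le hp]

theorem form_eq (hL : 0 < L) {p : V L × L2 L} {v : ℝ → ℝ} (hv : ContDiff ℝ ∞ v)
    (h1 : V.D 0 p.1 = toL2 L v) (h2 : p.2 = toL2 L fun x => x * deriv (deriv (deriv v)) x)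
    (u : V L) :
    form L p u = inner ℝ (V.D 1 u) (toL2 L fun x => x * v x)
      - inner ℝ (V.D 2 u) (toL2 L (deriv fun x => x * v x))
      + inner ℝ (V.D 2 u) (toL2 L (deriv (deriv (deriv fun x => x * v x)))) := by
  have hv1 := hv.deriv_infty
  have hv2 := hv1.deriv_infty
  have hv3 := hv2.deriv_infty
  have c := hv.continuous
  have c1 := hv1.continuous
  have c2 := hv2.continuous
  have c3 := hv3.continuous
  rw [form_apply, lowerForm_apply, h1, h2, V.D1_eq hL.le hv h1, V.D2_eq hL.le hv h1,
    mulX_toL2 c, mulX_toL2 c1, deriv_deriv_deriv_id_mul hv, deriv_id_mul hv,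
    toL2_add c (by fun_prop), toL2_add (by fun_prop) (by fun_prop), toL2_const_mul 3 c2,
    real_inner_comm, inner_add_right, inner_add_right, inner_smul_right, inner_add_left,
    real_inner_comm (V.D 2 u), real_inner_comm (V.D 2 u), real_inner_comm (V.D 2 u),
    real_inner_comm (V.D 2 u)]
  ring

theorem integral_Ioo_id (hL : 0 ≤ L) : ∫ x in Ioo 0 L, x = L ^ 2 / 2 := by
  rw [setIntegral_Ioo_eq_intervalIntegral hL, integral_id]; ring

theorem integral_Ioo_sq (hL : 0 ≤ L) : ∫ x in Ioo 0 L, x * x = L ^ 3 / 3 := by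
  simp only [← sq]
  rw [setIntegral_Ioo_eq_intervalIntegral hL, integral_pow]; norm_num

/-- Every smooth function is, up to an affine one, the second derivative of a smooth element
of `H²₀`. -/
theorem V.exists_D2_eq_affine (hL : 0 < L) {z : ℝ → ℝ} (hz : ContDiff ℝ ∞ z) :
    ∃ (u : V L) (v : ℝ → ℝ) (c₀ c₁ : ℝ), ContDiff ℝ ∞ v ∧ V.D 0 u = toL2 L v ∧
      deriv (deriv v) = fun x => z x - (c₀ * 1 + c₁ * x) := by
  obtain ⟨a, ha⟩ : ∃ a, a = ∫ x in Ioo 0 L, z x := ⟨_, rfl⟩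
  obtain ⟨b, hb⟩ : ∃ b, b = ∫ x in Ioo 0 L, x * z x := ⟨_, rfl⟩
  -- Solution of the system making `z - c₀ - c₁ x` orthogonal to `1` and `x`, the Gram entries being
  -- `L`, `L²/2`, `L³/3`; `12` comes from `L³/3 - L³/4 = L³/12`.
  obtain ⟨c₁, hc1⟩ : ∃ c, c = 12 * (b - a * L / 2) / L ^ 3 := ⟨_, rfl⟩
  obtain ⟨c₀, hc0⟩ : ∃ c, c = a / L - c₁ * L / 2 := ⟨_, rfl⟩
  have hw : ContDiff ℝ ∞ fun x => z x - (c₀ * 1 + c₁ * x) :=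
    hz.sub (contDiff_const.add (contDiff_const.mul contDiff_self))
  have cz := hz.continuous
  have m0 : ∫ x in Ioo 0 L, (z x - (c₀ * 1 + c₁ * x)) = 0 := by
    rw [integral_sub (Continuous.integrable_vol (by fun_prop) L)
      (Continuous.integrable_vol (by fun_prop) L), integral_add
      (Continuous.integrable_vol (by fun_prop) L) (Continuous.integrable_vol (by fun_prop) L),
      integral_const_mul, integral_const_mul, integral_Ioo_id hL.le, ← ha, hc0]
    simp [hL.le]
    field_simp
    ring
  have m1 : ∫ x in Ioo 0 L, x * (fun x => z x - (c₀ * 1 + c₁ * x)) x = 0 := by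
    have : ∀ x, x * (z x - (c₀ * 1 + c₁ * x)) = x * z x - (c₀ * x + c₁ * (x * x)) :=
      fun x => by ring
    simp only [this]
    rw [integral_sub (Continuous.integrable_vol (by fun_prop) L)
      (Continuous.integrable_vol (by fun_prop) L), integral_add
      (Continuous.integrable_vol (by fun_prop) L) (Continuous.integrable_vol (by fun_prop) L),
      integral_const_mul, integral_const_mul, integral_Ioo_id hL.le, integral_Ioo_sq hL.le,
      ← hb, hc0, hc1]
    field_simp
    ring
  generalize hwz : (fun x => z x - (c₀ * 1 + c₁ * x)) = w at hw m0 m1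
  have hw1 := contDiff_primitive hw
  have dw1 := deriv_primitive hw.continuous
  have hv := contDiff_primitive hw1
  have dv := deriv_primitive hw1.continuous
  set w1 : ℝ → ℝ := fun x => ∫ y in (0 : ℝ)..x, w y
  have e0 : w1 0 = 0 := intervalIntegral.integral_same
  have e1 : w1 L = 0 := (setIntegral_Ioo_eq_intervalIntegral hL.le w).symm.trans m0
  -- The zero mean of `w` makes its first primitive vanish at `L`; the zero first moment does the
  -- same for the second primitive.
  have e2 : ∫ x in Ioo 0 L, w1 x = 0 := by
    have := integral_deriv_mul hL.le hw1 contDiff_self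
    rw [dw1, e1, e0, deriv_id''] at this
    simp only [mul_comm (w _), m1] at this
    simpa using this.symm
  obtain ⟨u, hu⟩ := V.exists_of_smooth hL hv intervalIntegral.integral_same (by rw [dv, e0])
    (by rw [← setIntegral_Ioo_eq_intervalIntegral hL.le]; exact e2) (by rw [dv, e1])
  exact ⟨u, _, c₀, c₁, hv, hu, by rw [dv, dw1, hwz]⟩

/-- The energy identity for solutions of the stationary equation. -/
theorem energy_identity (hL : 0 < L) (u : V L) (M : V L →L[ℝ] ℝ)
    (h : ∀ p ∈ coreGraph L, form L p u = M p.1) : M u = quadForm u := by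
  -- With the bounded terms moved to the right, the equation reads `∫ x u_xx v_xxx = ∫ w_xx v_xx` on
  -- smooth `v` in `H²₀`.
  obtain ⟨w, hw⟩ := V.exists_inner_D2_eq hL.le (M - lowerForm' u)
  have key : mulX L (V.D 2 u) = - V.D 1 w := by
    refine eq_of_inner_toL2_test fun θ hθ => ?_
    have cθ := hθ.smooth.continuous
    have hz := contDiff_primitive hθ.smooth
    have dz := deriv_primitive cθ
    generalize (fun x => ∫ y in (0 : ℝ)..x, θ y) = z at hz dz
    have cz := hz.continuous
    -- Take `v_xx = z` up to an affine function, so that `v_xxx = θ - c₁`. The corrections drop out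
    -- because `u_xx` and `w_xx` are orthogonal to affine functions.
    obtain ⟨v, f, c₀, c₁, hf, hv, hf2⟩ := V.exists_D2_eq_affine hL hz
    have hf3 : deriv (deriv (deriv f)) = fun x => θ x - c₁ := by
      rw [hf2]
      funext x
      have h1 : HasDerivAt (fun x => z x - (c₀ * 1 + c₁ * x)) (θ x - c₁) x := by
        have a := (hz.differentiable_infty x).hasDerivAt
        rw [dz] at a
        have b := ((hasDerivAt_id x).const_mul c₁).const_add (c₀ * 1)
        simpa using a.fun_sub b
      exact h1.deriv
    have hp : (v, toL2 L fun x => x * deriv (deriv (deriv f)) x) ∈ coreGraph L :=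
      ⟨f, hf, hv, rfl⟩
    have h1 := h _ hp
    have h2 := hw v
    rw [form_apply] at h1
    simp only [hf3] at h1
    have e : (fun x => x * (θ x - c₁)) = fun x => x * θ x - c₁ * x := by funext x; ring
    rw [e, toL2_sub (by fun_prop) (by fun_prop), toL2_const_mul _ (by fun_prop), inner_sub_left,
      real_inner_smul_left, real_inner_comm (V.D 2 u), real_inner_comm (V.D 2 u),
      V.inner_D2_id u hL.le] at h1
    rw [V.D2_eq hL.le hf hv, hf2, sub_apply, lowerForm'_apply,
      toL2_sub cz (by fun_prop), toL2_add (by fun_prop) (by fun_prop),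
      toL2_const_mul _ (by fun_prop), toL2_const_mul _ (by fun_prop), inner_sub_right,
      inner_add_right, inner_smul_right, inner_smul_right, V.inner_D2_id w hL.le,
      V.inner_D2_one w hL.le, V.inner_D2_toL2 w hL.le hz, dz] at h2
    rw [inner_mulX_left, mulX_toL2 cθ, inner_neg_left]
    linarith
  -- Here `w_x / x = -u_xx`, so Hardy's identity reads `∫ w_xx u_xx = -1/2 |u_xx|²`. It replaces an
  -- integration by parts of `x u_xx u_xxx`; the natural condition at `L` is contained in `w_x`
  -- vanishing there.
  obtain ⟨Y, hY, hY'⟩ := V.exists_hardy w hL.le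
  have e : Y = - V.D 2 u := mulX_injective (by rw [hY, map_neg, key, neg_neg])
  have h2 := hw u
  rw [e, inner_neg_right, h2, norm_neg, sub_apply, lowerForm'_apply,
    lowerForm_self hL.le] at hY'
  linarith

/-- Test functions are in the domain of the spatial operator. -/
theorem exists_functional_of_test (hL : 0 < L) {φ : ℝ → ℝ} (hφ : IsTest L φ) {u : V L}
    (hu : V.D 0 u = toL2 L φ) : ∃ l : V L →L[ℝ] ℝ, ∀ p ∈ coreGraph L,
      form L p u = l (V.mulX hL.le p.1) := by
  have t1 := hφ.deriv
  have t2 := t1.deriv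
  have t3 := t2.deriv
  have t4 := t3.deriv
  have t5 := t4.deriv
  have c0 := hφ.smooth.continuous
  have c1 := t1.smooth.continuous
  have c3 := t3.smooth.continuous
  have c5 := t5.smooth.continuous
  -- The classical expression `φ' + φ''' - φ^(5)`, all derivatives being moved back onto the
  -- compactly supported `φ`.
  refine ⟨(innerSL ℝ (toL2 L (deriv φ) + toL2 L (deriv (deriv (deriv φ)))
    - toL2 L (deriv (deriv (deriv (deriv (deriv φ))))))).comp (V.D 0), ?_⟩
  rintro p ⟨v, hv, h1, h2⟩
  have e0 : V.D 0 (V.mulX hL.le p.1) = mulX L (V.D 0 p.1) := rfl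
  have hψ : ContDiff ℝ ∞ fun x => x * v x := contDiff_self.mul hv
  rw [form_eq hL hv h1 h2, ContinuousLinearMap.comp_apply, innerSL_apply_apply, e0, h1, mulX_toL2 hv.continuous,
    V.D1_eq hL.le hφ.smooth hu, V.D2_eq hL.le hφ.smooth hu, inner_sub_left, inner_add_left]
  generalize (fun x => x * v x) = ψ at hψ
  have s1 := hψ.deriv_infty
  have s2 := s1.deriv_infty
  have s3 := s2.deriv_infty
  have k : ∀ {f g : ℝ → ℝ}, IsTest L f → ContDiff ℝ ∞ g →
      inner ℝ (toL2 L f) (toL2 L (deriv g)) = - inner ℝ (toL2 L (deriv f)) (toL2 L g) := by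
    intro f g hf hg
    rw [inner_toL2_toL2 hf.smooth.continuous hg.deriv_infty.continuous,
      inner_toL2_toL2 hf.deriv.smooth.continuous hg.continuous, integral_test_mul_deriv hL.le hf hg,
      neg_neg]
  rw [k t2 s2, k t3 s1, k t4 hψ, k t2 hψ]
  ring

end

end Kawahara

/-! ### Bounded exponential moments, Lions' projection theorem, and density. -/

namespace Kawahara

open Filter Topology

theorem hasSum_one_sub_exp_neg (y : ℝ) :
    HasSum (fun k : ℕ => - ((-y) ^ (k + 1) / (k + 1).factorial)) (1 - Real.exp (-y)) := by
  have h := NormedSpace.expSeries_div_hasSum_exp (-y)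
  rw [← Real.exp_eq_exp_ℝ, ← hasSum_nat_add_iff' 1] at h
  simpa using h.neg

/-- The kernel `1 - exp(-e^{n(t-s)})` tends to the indicator of `t > s`. Its exponential series
involves only the moments of order `n (k + 1) ≥ n₀`, with coefficients of total size `exp(e^{-ns}) -
1`, which tends to `0` because `s > 0`. -/
theorem setIntegral_Ioi_eq_zero_of_bounded_moments {T : ℝ} {g : ℝ → ℝ}
    (hg : Integrable g (vol T)) {M : ℝ} {n₀ : ℕ}
    (h : ∀ n : ℕ, n₀ ≤ n → |∫ t in Ioo 0 T, Real.exp (n * t) * g t| ≤ M) {s : ℝ} (hs : 0 < s) :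
    ∫ t in Ioo 0 T, (Ioi s).indicator g t = 0 := by
  have hM : 0 ≤ M := (abs_nonneg _).trans (h n₀ le_rfl)
  have hexp : ∀ c : ℝ, Integrable (fun t => Real.exp (c * t) * g t) (vol T) := fun c => by
    refine hg.bdd_mul (c := Real.exp (|c| * |T|)) (by fun_prop) ?_
    refine (ae_restrict_mem measurableSet_Ioo).mono fun t ht => ?_
    rw [Real.norm_eq_abs, Real.abs_exp, Real.exp_le_exp]
    calc c * t ≤ |c * t| := le_abs_self _
      _ = |c| * |t| := abs_mul _ _
      _ ≤ |c| * |T| := mul_le_mul_of_nonneg_left (abs_le_of_mem_Ioo ht) (abs_nonneg c)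
  have bound : ∀ n : ℕ, n₀ ≤ n → 1 ≤ n →
      |∫ t in Ioo 0 T, (1 - Real.exp (-Real.exp (n * (t - s)))) * g t|
        ≤ M * (Real.exp (Real.exp (-(n * s))) - 1) := by
    intro n hn hn1
    set F : ℕ → ℝ → ℝ := fun k t =>
      - ((-Real.exp (n * (t - s))) ^ (k + 1) / (k + 1).factorial) * g t with hF
    have hFe : ∀ k t, F k t = ((-1) ^ k * (Real.exp (-(n * s)) ^ (k + 1) / (k + 1).factorial)) *
        (Real.exp (((n * (k + 1) : ℕ) : ℝ) * t) * g t) := by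
      intro k t
      have e : Real.exp (n * (t - s)) ^ (k + 1)
          = Real.exp (-(n * s)) ^ (k + 1) * Real.exp (((n * (k + 1) : ℕ) : ℝ) * t) := by
        rw [← Real.exp_nat_mul, ← Real.exp_nat_mul, ← Real.exp_add]
        congr 1
        push_cast
        ring
      simp only [hF]
      rw [neg_pow, e, pow_succ (-1 : ℝ) k]
      ring
    have hFi : ∀ k, Integrable (F k) (vol T) := fun k => by
      rw [show F k = _ from funext (hFe k)]
      exact (hexp _).const_mul _
    have hsum : ∀ t, HasSum (fun k => F k t) ((1 - Real.exp (-Real.exp (n * (t - s)))) * g t) :=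
      fun t => (hasSum_one_sub_exp_neg _).mul_right _
    have hnorm : Summable fun k => ∫ t in Ioo 0 T, ‖F k t‖ := by
      have hE := (Real.summable_pow_div_factorial (Real.exp (n * |T|)))
      have hE1 := ((summable_nat_add_iff 1).2 hE).mul_right (∫ t in Ioo 0 T, ‖g t‖)
      refine Summable.of_nonneg_of_le (fun k => integral_nonneg fun t => norm_nonneg _) (fun k => ?_)
        hE1
      rw [← integral_const_mul]
      refine integral_mono_ae (hFi k).norm (hg.norm.const_mul _) ?_
      refine (ae_restrict_mem measurableSet_Ioo).mono fun t ht => ?_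
      simp only [hF, norm_mul, norm_neg, norm_div, norm_pow, Real.norm_eq_abs, Real.abs_exp,
        Nat.abs_cast]
      refine mul_le_mul_of_nonneg_right ?_ (abs_nonneg _)
      refine div_le_div_of_nonneg_right ?_ (Nat.cast_nonneg _)
      refine pow_le_pow_left₀ (Real.exp_nonneg _) (Real.exp_le_exp.2 ?_) _
      refine mul_le_mul_of_nonneg_left ?_ (Nat.cast_nonneg _)
      have := abs_le_of_mem_Ioo ht
      linarith [le_abs_self t]
    have hI := hasSum_integral_of_summable_integral_norm hFi hnorm
    simp only [fun t => (hsum t).tsum_eq] at hI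
    have hR : HasSum (fun k : ℕ => M * (Real.exp (-(n * s)) ^ (k + 1) / (k + 1).factorial))
        (M * (Real.exp (Real.exp (-(n * s))) - 1)) := by
      have a := (hasSum_one_sub_exp_neg (-Real.exp (-(n * s)))).neg
      simp only [neg_neg, neg_sub] at a
      exact a.mul_left M
    refine hI.norm_le_of_bounded hR fun k => ?_
    rw [Real.norm_eq_abs]
    simp only [hFe]
    rw [integral_const_mul, abs_mul, abs_mul, abs_pow, abs_neg, abs_one, one_pow, one_mul,
      abs_of_nonneg (by positivity), mul_comm]
    refine mul_le_mul_of_nonneg_right (h _ ?_) (by positivity)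
    exact hn.trans (Nat.le_mul_of_pos_right n (Nat.succ_pos k))
  have lim0 : Tendsto (fun n : ℕ => M * (Real.exp (Real.exp (-(n * s))) - 1)) atTop (𝓝 0) := by
    have a : Tendsto (fun n : ℕ => (n : ℝ) * s) atTop atTop :=
      tendsto_natCast_atTop_atTop.atTop_mul_const hs
    have b := Real.tendsto_exp_neg_atTop_nhds_zero.comp a
    have c := (((Real.continuous_exp.tendsto 0).comp b).sub_const 1).const_mul M
    simpa using c
  have lim1 : Tendsto (fun n : ℕ => ∫ t in Ioo 0 T, (1 - Real.exp (-Real.exp (n * (t - s)))) * g t)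
      atTop (𝓝 0) := by
    refine squeeze_zero_norm' ?_ lim0
    filter_upwards [eventually_ge_atTop n₀, eventually_ge_atTop 1] with n hn hn1
    exact bound n hn hn1
  refine tendsto_nhds_unique ?_ lim1
  refine tendsto_integral_of_dominated_convergence (fun t => ‖g t‖) (fun n => ?_) hg.norm
    (fun n => ?_) ?_
  · exact AEStronglyMeasurable.mul (by fun_prop) hg.aestronglyMeasurable
  · refine Eventually.of_forall fun t => ?_
    rw [norm_mul]
    refine mul_le_of_le_one_left (norm_nonneg _) ?_
    rw [Real.norm_eq_abs, abs_le]
    have := Real.exp_pos (-Real.exp (n * (t - s)))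
    have := Real.exp_le_one_iff.2 (neg_nonpos.2 (Real.exp_nonneg (n * (t - s))))
    constructor <;> linarith
  · have hne : ∀ᵐ t ∂(vol T), t ≠ s := by
      refine ae_restrict_of_ae ?_
      simp [ae_iff, measure_singleton]
    filter_upwards [hne] with t ht
    rcases lt_or_gt_of_ne ht with h1 | h1
    · rw [indicator_of_notMem (by simpa using h1.le)]
      have a : Tendsto (fun n : ℕ => (n : ℝ) * (t - s)) atTop atBot :=
        tendsto_natCast_atTop_atTop.atTop_mul_const_of_neg (by linarith)
      have b := (Real.tendsto_exp_atBot.comp a).neg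
      have c := ((((Real.continuous_exp.tendsto _).comp b)).const_sub 1).mul_const (g t)
      simpa using c
    · rw [indicator_of_mem (by simpa using h1)]
      have a : Tendsto (fun n : ℕ => (n : ℝ) * (t - s)) atTop atTop :=
        tendsto_natCast_atTop_atTop.atTop_mul_const (by linarith)
      have b := Real.tendsto_exp_neg_atTop_nhds_zero.comp (Real.tendsto_exp_atTop.comp a)
      have c := (b.const_sub 1).mul_const (g t)
      simpa using c

/-- A function on `(0, T)` with bounded exponential moments vanishes. -/
theorem ae_eq_zero_of_bounded_moments {T : ℝ} {g : ℝ → ℝ}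
    (hg : Integrable g (vol T)) {M : ℝ} {n₀ : ℕ}
    (h : ∀ n : ℕ, n₀ ≤ n → |∫ t in Ioo 0 T, Real.exp (n * t) * g t| ≤ M) :
    g =ᵐ[vol T] 0 := by
  set G : ℝ → ℝ := (Ioo 0 T).indicator g with hG
  have hGi : Integrable G := (integrable_indicator_iff measurableSet_Ioo).2 hg
  have key : ∀ s, 0 < s → s < T → ∫ t in T..s, G t = 0 := by
    intro s hs hsT
    have := setIntegral_Ioi_eq_zero_of_bounded_moments hg h hs
    rw [intervalIntegral.integral_symm, intervalIntegral.integral_of_le hsT.le, neg_eq_zero]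
    rw [setIntegral_indicator measurableSet_Ioi] at this
    have e : Ioc s T ∩ Ioo 0 T = Ioo 0 T ∩ Ioi s := by
      ext x
      simp only [mem_inter_iff, mem_Ioc, mem_Ioo, mem_Ioi]
      constructor
      · rintro ⟨⟨h1, h2⟩, h3, h4⟩
        exact ⟨⟨h3, h4⟩, h1⟩
      · rintro ⟨⟨h3, h4⟩, h1⟩
        exact ⟨⟨h1, h4.le⟩, h3, h4⟩
    rw [hG, setIntegral_indicator measurableSet_Ioo, e, this]
  refine (ae_restrict_iff' measurableSet_Ioo).2 ?_
  -- The tail integrals vanish for every `s` in `(0, T)`; Lebesgue differentiation concludes.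
  filter_upwards [LocallyIntegrable.ae_hasDerivAt_integral hGi.locallyIntegrable] with x hx hxT
  have h1 := hx T
  have h2 : (fun s => ∫ t in T..s, G t) =ᶠ[𝓝 x] fun _ => 0 := by
    filter_upwards [isOpen_Ioo.mem_nhds hxT] with y hy
    exact key y hy.1 hy.2
  have h3 := h1.unique ((hasDerivAt_const x (0 : ℝ)).congr_of_eventuallyEq h2)
  rwa [hG, indicator_of_mem hxT] at h3

/-- Lions' projection theorem. -/
theorem exists_forall_inner_eq {V : Type*} [NormedAddCommGroup V] [InnerProductSpace ℝ V]
    [CompleteSpace V] (N : Submodule ℝ (V × (V →L[ℝ] ℝ))) {α : ℝ} (hα : 0 < α)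
    (hN : ∀ p ∈ N, α * ‖p.1‖ ^ 2 ≤ p.2 p.1) (M : V →L[ℝ] ℝ) :
    ∃ u : V, ‖u‖ ≤ ‖M‖ / α ∧ ∀ p ∈ N, p.2 u = M p.1 := by
  have hle : ∀ p ∈ N, α * ‖p.1‖ ≤ ‖p.2‖ := by
    intro p hp
    rcases (norm_nonneg p.1).eq_or_lt with h0 | h0
    · rw [← h0, mul_zero]; exact norm_nonneg _
    · refine le_of_mul_le_mul_right ?_ h0
      calc α * ‖p.1‖ * ‖p.1‖ = α * ‖p.1‖ ^ 2 := by ring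
        _ ≤ p.2 p.1 := hN p hp
        _ ≤ ‖p.2‖ * ‖p.1‖ := (le_abs_self _).trans (p.2.le_opNorm _)
  -- Coercivity makes `p.2` determine `p.1`, so `p.2 ↦ M p.1` is a well-defined functional of norm
  -- at most `‖M‖ / α` on a subspace of the dual. Hahn–Banach extends it, and reflexivity represents
  -- the extension by a vector `u`.
  let Φ : N →ₗ[ℝ] (V →L[ℝ] ℝ) := (LinearMap.snd ℝ V (V →L[ℝ] ℝ)).comp N.subtype
  have hΦ : Function.Injective Φ := by
    rw [injective_iff_map_eq_zero]
    rintro ⟨p, hp⟩ h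
    have h' : p.2 = 0 := h
    have h1 := hle p hp
    rw [h', norm_zero] at h1
    have h2 : ‖p.1‖ = 0 := by nlinarith [norm_nonneg p.1]
    exact Subtype.ext (Prod.ext (norm_eq_zero.1 h2) h')
  let e := LinearEquiv.ofInjective Φ hΦ
  let φ : LinearMap.range Φ →ₗ[ℝ] ℝ :=
    M.toLinearMap.comp ((LinearMap.fst ℝ V (V →L[ℝ] ℝ)).comp (N.subtype.comp e.symm.toLinearMap))
  have hφ : ∀ k, ‖φ k‖ ≤ ‖M‖ / α * ‖k‖ := by
    intro k
    obtain ⟨p, rfl⟩ := e.surjective k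
    have e1 : φ (e p) = M p.1.1 := by simp [φ]
    have e2 : ‖e p‖ = ‖p.1.2‖ := rfl
    rw [e1, e2, div_mul_eq_mul_div, le_div_iff₀ hα]
    calc ‖M p.1.1‖ * α ≤ ‖M‖ * ‖p.1.1‖ * α := by gcongr; exact M.le_opNorm _
      _ = ‖M‖ * (α * ‖p.1.1‖) := by ring
      _ ≤ ‖M‖ * ‖p.1.2‖ := by gcongr; exact hle p.1 p.2
  obtain ⟨G, hG, hGn⟩ := exists_extension_norm_eq (LinearMap.range Φ)
    (φ.mkContinuous _ hφ)
  obtain ⟨u, hu, hun⟩ : ∃ u : V, (∀ k : V →L[ℝ] ℝ, k u = G k) ∧ ‖u‖ ≤ ‖G‖ := by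
    refine ⟨(InnerProductSpace.toDual ℝ V).symm (G.comp (innerSL ℝ)), fun k => ?_, ?_⟩
    · obtain ⟨v, rfl⟩ := (InnerProductSpace.toDual ℝ V).surjective k
      rw [InnerProductSpace.toDual_apply_apply, real_inner_comm,
        InnerProductSpace.toDual_symm_apply]
      rfl
    · rw [LinearIsometryEquiv.norm_map]
      refine ContinuousLinearMap.opNorm_le_bound _ (norm_nonneg _) fun v => ?_
      have := G.le_opNorm (innerSL ℝ v)
      rwa [innerSL_apply_norm] at this
  refine ⟨u, ?_, fun p hp => ?_⟩
  · refine hun.trans ?_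
    rw [hGn]
    exact LinearMap.mkContinuous_norm_le _ (by positivity) _
  · have h1 := hG (e ⟨p, hp⟩)
    have e1 : φ (e ⟨p, hp⟩) = M p.1 := by simp [φ]
    rw [LinearMap.mkContinuous_apply, e1] at h1
    rw [hu, ← h1]; rfl

/-- A subspace annihilated only by the zero functional is dense. -/
theorem dense_of_forall_dual {E : Type*} [NormedAddCommGroup E] [NormedSpace ℝ E]
    (S : Submodule ℝ E) (h : ∀ Λ : E →L[ℝ] ℝ, (∀ x ∈ S, Λ x = 0) → Λ = 0) :
    Dense (S : Set E) := by
  by_contra hd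
  obtain ⟨x, hx⟩ : ∃ x, x ∉ S.topologicalClosure := by
    by_contra! hc
    exact hd fun x => hc x
  obtain ⟨f, r, hf, hfx⟩ := geometric_hahn_banach_closed_point
    (s := (S.topologicalClosure : Set E)) S.topologicalClosure.convex
    S.isClosed_topologicalClosure hx
  have h0 : ∀ y ∈ S, f y = 0 := by
    intro y hy
    by_contra hne
    have := hf (((r + 1) / f y) • y) (S.le_topologicalClosure (S.smul_mem _ hy))
    rw [map_smul, smul_eq_mul, div_mul_cancel₀ _ hne] at this
    linarith
  have h1 := hf 0 (Submodule.zero_mem _)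
  have := h f h0
  rw [this] at hfx h1
  simp at hfx h1
  linarith

end Kawahara

/-! ### Abstract evolution equation: resolvents and strong solutions. -/

namespace Kawahara

open Filter Topology

noncomputable section

theorem Lp_norm_sq {Ω E : Type*} [MeasurableSpace Ω] {μ : Measure Ω} [NormedAddCommGroup E]
    (F : Lp E 2 μ) : ‖F‖ ^ 2 = ∫ t, ‖F t‖ ^ 2 ∂μ := by
  have h0 : 0 ≤ ∫ t, ‖F t‖ ^ 2 ∂μ := integral_nonneg fun t => by positivity
  rw [Lp.norm_def, (Lp.memLp F).eLpNorm_eq_integral_rpow_norm two_ne_zero ENNReal.ofNat_ne_top]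
  simp only [ENNReal.toReal_ofNat, Real.rpow_ofNat]
  rw [ENNReal.toReal_ofReal (by positivity), ← Real.rpow_natCast, ← Real.rpow_mul h0]
  norm_num

theorem integrable_Lp {E : Type*} [NormedAddCommGroup E] {T : ℝ} (U : Lp E 2 (vol T)) :
    Integrable (fun s => U s) (vol T) :=
  (Lp.memLp U).integrable (by norm_num)

theorem vol_mono {t T : ℝ} (ht : t ≤ T) : vol t ≤ vol T :=
  Measure.restrict_mono (Ioo_subset_Ioo_right ht) le_rfl

theorem integrable_Lp_restrict {E : Type*} [NormedAddCommGroup E] {t T : ℝ} (ht : t ≤ T)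
    (U : Lp E 2 (vol T)) :
    Integrable (fun s => U s) (vol t) :=
  (integrable_Lp U).mono_measure (vol_mono ht)

section TimeIntegral

variable {E : Type*} [NormedAddCommGroup E] [NormedSpace ℝ E] {T : ℝ}

/-- The functional `U ↦ ∫₀ᵗ φ(U(s)) ds` on `L²(0, T; E)`. -/
def timeIntegral (T : ℝ) (φ : E →L[ℝ] ℝ) (t : ℝ) : Lp E 2 (vol T) →L[ℝ] ℝ :=
  (innerSL ℝ (indicatorConstLp 2 (measurableSet_Ioo (a := (0 : ℝ)) (b := t))
    (measure_ne_top (vol T) _) (1 : ℝ))).comp (φ.compLpL 2 (vol T))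

theorem vol_restrict {t : ℝ} (ht : t ≤ T) : (vol T).restrict (Ioo 0 t) = vol t :=
  Measure.restrict_restrict_of_subset (Ioo_subset_Ioo_right ht)

theorem timeIntegral_apply (φ : E →L[ℝ] ℝ) {t : ℝ} (ht : t ≤ T) (U : Lp E 2 (vol T)) :
    timeIntegral T φ t U = ∫ s in Ioo 0 t, φ (U s) := by
  rw [timeIntegral, ContinuousLinearMap.comp_apply, innerSL_apply_apply,
    L2.inner_indicatorConstLp_one, vol_restrict ht]
  exact integral_congr_ae (ae_mono (vol_mono ht) (φ.coeFn_compLpL U))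

end TimeIntegral

section Abstract

variable {V H : Type*} [NormedAddCommGroup V] [InnerProductSpace ℝ V]
  [NormedAddCommGroup H] [InnerProductSpace ℝ H]

/-- The data of an abstract evolution equation `u_t + A u = f`, where `A` is given by its graph
against a space `N` of pairs consisting of a test vector `v` and the functional `u ↦ ⟨A u, v⟩`. -/
structure IsDissipative (ι : V →L[ℝ] H) (X : V →L[ℝ] V) (N : Submodule ℝ (V × (V →L[ℝ] ℝ)))
    (α lam : ℝ) : Prop where
  pos : 0 < α
  nonneg : 0 ≤ lam
  inj : Function.Injective ι
  -- This bound concerns solutions of the stationary equation and gives a priori estimates and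
  -- uniqueness; `coercive` concerns test vectors and gives solvability. Neither implies the other,
  -- as `u` need not be a test vector.
  energy : ∀ (u : V) (M : V →L[ℝ] ℝ), (∀ p ∈ N, p.2 u = M p.1) →
    α * ‖u‖ ^ 2 ≤ M u + lam * ‖ι u‖ ^ 2
  coercive : ∀ p ∈ N, α * ‖p.1‖ ^ 2 ≤ p.2 p.1 + lam * ‖ι p.1‖ ^ 2
  dense : ∀ h : H, (∀ u : V, (∃ l : V →L[ℝ] ℝ, ∀ p ∈ N, p.2 u = l (X p.1)) →
    inner ℝ h (ι u) = 0) → h = 0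

/-- The inner product of `H` on `V`. -/
def pivot (ι : V →L[ℝ] H) : V →L[ℝ] V →L[ℝ] ℝ := (innerSL ℝ).bilinearComp ι ι

theorem pivot_apply (ι : V →L[ℝ] H) (u v : V) : pivot ι u v = inner ℝ (ι u) (ι v) := rfl

variable {ι : V →L[ℝ] H} {X : V →L[ℝ] V} {N : Submodule ℝ (V × (V →L[ℝ] ℝ))} {α lam : ℝ}

/-- Lions' theorem for the graph shifted by `μ`. Once `lam ≤ μ` the shift only helps coercivity, so
the bound does not depend on `μ`; the density argument rests on this uniformity. -/
theorem IsDissipative.exists_resolvent [CompleteSpace V]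
    (hd : IsDissipative ι X N α lam) {μ : ℝ} (hμ : lam ≤ μ)
    (M : V →L[ℝ] ℝ) :
    ∃ u : V, ‖u‖ ≤ ‖M‖ / α ∧ ∀ p ∈ N, p.2 u + μ * inner ℝ (ι u) (ι p.1) = M p.1 := by
  let S : V × (V →L[ℝ] ℝ) →ₗ[ℝ] V × (V →L[ℝ] ℝ) :=
    (LinearMap.fst ℝ V (V →L[ℝ] ℝ)).prod (LinearMap.snd ℝ V (V →L[ℝ] ℝ)
      + μ • (pivot ι).toLinearMap.comp (LinearMap.fst ℝ V (V →L[ℝ] ℝ)))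
  have hS : ∀ p u, (S p).2 u = p.2 u + μ * inner ℝ (ι p.1) (ι u) := fun p u => rfl
  have hS1 : ∀ p, (S p).1 = p.1 := fun p => rfl
  obtain ⟨u, hu, h⟩ := exists_forall_inner_eq (N.map S) hd.pos (by
    rintro _ ⟨p, hp, rfl⟩
    rw [hS, hS1, real_inner_self_eq_norm_sq]
    have := hd.coercive p hp
    nlinarith [sq_nonneg ‖ι p.1‖]) M
  refine ⟨u, hu, fun p hp => ?_⟩
  rw [real_inner_comm, ← hS, h _ (Submodule.mem_map_of_mem hp), hS1]

/-- Strong solutions of the evolution equation. -/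
structure IsStrongSol (ι : V →L[ℝ] H) (X : V →L[ℝ] V) (N : Submodule ℝ (V × (V →L[ℝ] ℝ)))
    (u u' : ℝ → V) (f : ℝ → V →L[ℝ] ℝ) : Prop where
  hasDerivAt : ∀ t, HasDerivAt u (u' t) t
  continuous_deriv : Continuous u'
  continuous_data : Continuous f
  eq : ∀ t, ∀ p ∈ N, p.2 (u t) + inner ℝ (ι (u' t)) (ι p.1) = f t (X p.1)

namespace IsStrongSol

variable {u u' v v' : ℝ → V} {f g : ℝ → V →L[ℝ] ℝ}

theorem continuous (h : IsStrongSol ι X N u u' f) : Continuous u :=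
  continuous_iff_continuousAt.2 fun t => (h.hasDerivAt t).continuousAt

theorem add (h : IsStrongSol ι X N u u' f) (h' : IsStrongSol ι X N v v' g) :
    IsStrongSol ι X N (fun t => u t + v t) (fun t => u' t + v' t) (fun t => f t + g t) where
  hasDerivAt t := (h.hasDerivAt t).add (h'.hasDerivAt t)
  continuous_deriv := h.continuous_deriv.add h'.continuous_deriv
  continuous_data := h.continuous_data.add h'.continuous_data
  eq t p hp := by
    rw [add_apply, ← h.eq t p hp, ← h'.eq t p hp, map_add, map_add, inner_add_left]; ring

theorem smul (h : IsStrongSol ι X N u u' f) (c : ℝ) :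
    IsStrongSol ι X N (fun t => c • u t) (fun t => c • u' t) (fun t => c • f t) where
  hasDerivAt t := (h.hasDerivAt t).const_smul c
  continuous_deriv := h.continuous_deriv.const_smul c
  continuous_data := h.continuous_data.const_smul c
  eq t p hp := by
    rw [smul_apply, ← h.eq t p hp, map_smul, map_smul, real_inner_smul_left, smul_eq_mul,
      smul_eq_mul]
    ring

theorem zero : IsStrongSol ι X N (fun _ => 0) (fun _ => 0) (fun _ => 0) where
  hasDerivAt _ := hasDerivAt_const _ _
  continuous_deriv := continuous_const
  continuous_data := continuous_const
  eq t p hp := by simp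

/-- Exponential solutions. -/
theorem exp {w : V} {l : V →L[ℝ] ℝ} {μ : ℝ}
    (h : ∀ p ∈ N, p.2 w + μ * inner ℝ (ι w) (ι p.1) = l (X p.1)) :
    IsStrongSol ι X N (fun t => Real.exp (μ * t) • w) (fun t => (μ * Real.exp (μ * t)) • w)
      (fun t => Real.exp (μ * t) • l) where
  hasDerivAt t := by
    have := (((hasDerivAt_id t).const_mul μ).exp).smul_const w
    simpa [mul_comm] using this
  continuous_deriv := by fun_prop
  continuous_data := by fun_prop
  eq t p hp := by
    rw [smul_apply, ← h p hp, map_smul, map_smul, real_inner_smul_left, smul_eq_mul, smul_eq_mul]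
    ring

/-- At fixed time the equation is stationary with right-hand side `f ∘ X - u'`; apply the energy
bound and Young's inequality. -/
theorem inner_deriv_le (hd : IsDissipative ι X N α lam) (h : IsStrongSol ι X N u u' f) (t : ℝ) :
    2 * inner ℝ (ι (u t)) (ι (u' t)) ≤
      2 * lam * ‖ι (u t)‖ ^ 2 - (α * ‖u t‖ ^ 2 - ‖X‖ ^ 2 / α * ‖f t‖ ^ 2) := by
  have hα := hd.pos
  have h1 := hd.energy (u t) ((f t).comp X - pivot ι (u' t)) fun p hp => by
    rw [sub_apply, ContinuousLinearMap.comp_apply, ← h.eq t p hp, pivot_apply]; ring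
  rw [sub_apply, ContinuousLinearMap.comp_apply, pivot_apply, real_inner_comm] at h1
  have h2 : f t (X (u t)) ≤ ‖f t‖ * (‖X‖ * ‖u t‖) :=
    (le_abs_self _).trans (((f t).le_opNorm _).trans
      (mul_le_mul_of_nonneg_left (X.le_opNorm _) (norm_nonneg _)))
  have h3 : 2 * (‖f t‖ * (‖X‖ * ‖u t‖)) ≤ α * ‖u t‖ ^ 2 + ‖X‖ ^ 2 / α * ‖f t‖ ^ 2 := by
    have := sq_nonneg (α * ‖u t‖ - ‖X‖ * ‖f t‖)
    have e : α * ‖u t‖ ^ 2 + ‖X‖ ^ 2 / α * ‖f t‖ ^ 2 - 2 * (‖f t‖ * (‖X‖ * ‖u t‖))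
        = (α * ‖u t‖ - ‖X‖ * ‖f t‖) ^ 2 / α := by
      field_simp
      ring
    have := div_nonneg this hα.le
    linarith
  linarith

/-- The energy estimate. -/
theorem energy_le (hd : IsDissipative ι X N α lam) (h : IsStrongSol ι X N u u' f) {t : ℝ}
    (ht : 0 ≤ t) :
    ‖ι (u t)‖ ^ 2 + α * ∫ s in (0 : ℝ)..t, ‖u s‖ ^ 2 ≤
      Real.exp (2 * lam * t) *
        (‖ι (u 0)‖ ^ 2 + ‖X‖ ^ 2 / α * ∫ s in (0 : ℝ)..t, ‖f s‖ ^ 2) := by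
  have hα := hd.pos
  have hl := hd.nonneg
  have cu := h.continuous
  have cf := h.continuous_data
  set c := ‖X‖ ^ 2 / α with hc
  have hc0 : 0 ≤ c := by positivity
  let w : ℝ → ℝ := fun s => Real.exp (-(2 * lam) * s) * (α * ‖u s‖ ^ 2 - c * ‖f s‖ ^ 2)
  have cw : Continuous w := by fun_prop
  -- Gronwall by integrating factor: `E` is nonincreasing.
  let E : ℝ → ℝ := fun t => Real.exp (-(2 * lam) * t) * ‖ι (u t)‖ ^ 2 + ∫ s in (0 : ℝ)..t, w s
  have hE : ∀ t, HasDerivAt E (Real.exp (-(2 * lam) * t) * (-(2 * lam) * ‖ι (u t)‖ ^ 2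
      + 2 * inner ℝ (ι (u t)) (ι (u' t)) + (α * ‖u t‖ ^ 2 - c * ‖f t‖ ^ 2))) t := by
    intro t
    have h1 : HasDerivAt (fun t => ι (u t)) (ι (u' t)) t := ι.hasFDerivAt.comp_hasDerivAt t
      (h.hasDerivAt t)
    have h2 := h1.norm_sq
    have h3 := ((hasDerivAt_id t).const_mul (-(2 * lam))).exp
    have h4 := (h3.fun_mul h2).add (cw.integral_hasStrictDerivAt 0 t).hasDerivAt
    refine h4.congr_deriv ?_
    simp only [w, id, mul_one]
    ring
  have hanti : Antitone E := by
    refine antitone_of_deriv_nonpos (fun t => (hE t).differentiableAt) fun t => ?_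
    rw [(hE t).deriv]
    refine mul_nonpos_of_nonneg_of_nonpos (Real.exp_nonneg _) ?_
    have := h.inner_deriv_le hd t
    linarith
  have h0 := hanti ht
  simp only [E, intervalIntegral.integral_same, mul_zero, Real.exp_zero, one_mul, add_zero] at h0
  have hw : Real.exp (-(2 * lam) * t) * (α * ∫ s in (0 : ℝ)..t, ‖u s‖ ^ 2)
      - c * ∫ s in (0 : ℝ)..t, ‖f s‖ ^ 2 ≤ ∫ s in (0 : ℝ)..t, w s := by
    rw [← intervalIntegral.integral_const_mul, ← intervalIntegral.integral_const_mul,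
      ← intervalIntegral.integral_const_mul, ← intervalIntegral.integral_sub
      (Continuous.intervalIntegrable (by fun_prop) _ _)
      (Continuous.intervalIntegrable (by fun_prop) _ _)]
    refine intervalIntegral.integral_mono_on ht (Continuous.intervalIntegrable (by fun_prop) _ _)
      (cw.intervalIntegrable _ _) fun s hs => ?_
    have e1 : Real.exp (-(2 * lam) * t) ≤ Real.exp (-(2 * lam) * s) :=
      Real.exp_le_exp.2 (by nlinarith [hs.2])
    have e2 : Real.exp (-(2 * lam) * s) ≤ 1 := Real.exp_le_one_iff.2 (by nlinarith [hs.1])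
    have i1 := mul_le_mul_of_nonneg_right e1 (by positivity : 0 ≤ α * ‖u s‖ ^ 2)
    have i2 := mul_le_mul_of_nonneg_right e2 (by positivity : 0 ≤ c * ‖f s‖ ^ 2)
    simp only [w]
    linarith
  have h5 : Real.exp (-(2 * lam) * t) * (‖ι (u t)‖ ^ 2 + α * ∫ s in (0 : ℝ)..t, ‖u s‖ ^ 2)
      ≤ ‖ι (u 0)‖ ^ 2 + c * ∫ s in (0 : ℝ)..t, ‖f s‖ ^ 2 := by linarith
  have h6 := mul_le_mul_of_nonneg_left h5 (Real.exp_nonneg (2 * lam * t))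
  rwa [← mul_assoc, ← Real.exp_add, neg_mul, add_neg_cancel, Real.exp_zero, one_mul] at h6

end IsStrongSol

end Abstract

end

end Kawahara

/-! ### Weak solutions of the abstract equation: existence and uniqueness. -/

namespace Kawahara

open Filter Topology

noncomputable section

section Abstract

variable {V H : Type*} [NormedAddCommGroup V] [InnerProductSpace ℝ V]
  [NormedAddCommGroup H] [InnerProductSpace ℝ H]

/-- Weak solutions of the evolution equation. -/
structure IsWeakSol (ι : V →L[ℝ] H) (X : V →L[ℝ] V) (N : Submodule ℝ (V × (V →L[ℝ] ℝ)))
    {T : ℝ} (c : C(Icc (0 : ℝ) T, H)) (U : Lp V 2 (vol T)) (u₀ : H)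
    (f : Lp (V →L[ℝ] ℝ) 2 (vol T)) : Prop where
  initial : ∀ h : (0 : ℝ) ∈ Icc (0 : ℝ) T, c ⟨0, h⟩ = u₀
  compat : ∀ᵐ t ∂(vol T), ∀ ht : t ∈ Icc (0 : ℝ) T, c ⟨t, ht⟩ = ι (U t)
  weak : ∀ p ∈ N, ∀ t : Icc (0 : ℝ) T,
    inner ℝ (c t) (ι p.1) - inner ℝ u₀ (ι p.1) + ∫ s in Ioo 0 (t : ℝ), p.2 (U s)
      = ∫ s in Ioo 0 (t : ℝ), f s (X p.1)

/-- Pairs of a weak solution and its data. -/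
abbrev SolData (V H : Type*) [NormedAddCommGroup V] [InnerProductSpace ℝ V]
    [NormedAddCommGroup H] [InnerProductSpace ℝ H] (T : ℝ) : Type _ :=
  (C(Icc (0 : ℝ) T, H) × Lp V 2 (vol T)) × (H × Lp (V →L[ℝ] ℝ) 2 (vol T))

variable {ι : V →L[ℝ] H} {X : V →L[ℝ] V} {N : Submodule ℝ (V × (V →L[ℝ] ℝ))} {α lam T : ℝ}

/-- Strong solutions, with their data. -/
def strongGraph (ι : V →L[ℝ] H) (X : V →L[ℝ] V) (N : Submodule ℝ (V × (V →L[ℝ] ℝ))) (T : ℝ) :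
    Submodule ℝ (SolData V H T) where
  carrier := {y | ∃ u u' f, IsStrongSol ι X N u u' f ∧ (∀ t, y.1.1 t = ι (u t)) ∧
    y.1.2 =ᵐ[vol T] u ∧ y.2.1 = ι (u 0) ∧ y.2.2 =ᵐ[vol T] f}
  add_mem' := by
    rintro y z ⟨u, u', f, h, h1, h2, h3, h4⟩ ⟨v, v', g, k, k1, k2, k3, k4⟩
    refine ⟨_, _, _, h.add k, fun t => ?_, ?_, ?_, ?_⟩
    · rw [map_add, ← h1, ← k1]; rfl
    · filter_upwards [Lp.coeFn_add y.1.2 z.1.2, h2, k2] with t e1 e2 e3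
      exact e1.trans (by rw [Pi.add_apply, e2, e3])
    · rw [map_add, ← h3, ← k3]; rfl
    · filter_upwards [Lp.coeFn_add y.2.2 z.2.2, h4, k4] with t e1 e2 e3
      exact e1.trans (by rw [Pi.add_apply, e2, e3])
  zero_mem' := by
    refine ⟨_, _, _, IsStrongSol.zero, fun t => ?_, Lp.coeFn_zero _ _ _, ?_, Lp.coeFn_zero _ _ _⟩
    · rw [map_zero]; rfl
    · rw [map_zero]; rfl
  smul_mem' := by
    rintro a y ⟨u, u', f, h, h1, h2, h3, h4⟩
    refine ⟨_, _, _, h.smul a, fun t => ?_, ?_, ?_, ?_⟩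
    · rw [map_smul, ← h1]; rfl
    · filter_upwards [Lp.coeFn_smul a y.1.2, h2] with t e1 e2
      exact e1.trans (by rw [Pi.smul_apply, e2])
    · rw [map_smul, ← h3]; rfl
    · filter_upwards [Lp.coeFn_smul a y.2.2, h4] with t e1 e2
      exact e1.trans (by rw [Pi.smul_apply, e2])

theorem IsStrongSol.exists_mem_strongGraph {u u' : ℝ → V} {f : ℝ → V →L[ℝ] ℝ}
    (h : IsStrongSol ι X N u u' f) (T : ℝ) :
    ∃ y ∈ strongGraph ι X N T, y.2.1 = ι (u 0) ∧ y.2.2 =ᵐ[vol T] f :=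
  ⟨((⟨fun t => ι (u t), ι.continuous.comp (h.continuous.comp continuous_subtype_val)⟩,
      (h.continuous.memLp_vol T).toLp), (ι (u 0), (h.continuous_data.memLp_vol T).toLp)),
    ⟨u, u', f, h, fun _ => rfl, (h.continuous.memLp_vol T).coeFn_toLp, rfl,
      (h.continuous_data.memLp_vol T).coeFn_toLp⟩, rfl, (h.continuous_data.memLp_vol T).coeFn_toLp⟩

theorem isWeakSol_of_mem_strongGraph {y : SolData V H T} (hy : y ∈ strongGraph ι X N T) :
    IsWeakSol ι X N y.1.1 y.1.2 y.2.1 y.2.2 := by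
  obtain ⟨u, u', f, h, h1, h2, h3, h4⟩ := hy
  refine ⟨fun h0 => by rw [h1, h3], ?_, fun p hp t => ?_⟩
  · filter_upwards [h2] with t ht _
    rw [h1, ht]
  have hd : ∀ s, HasDerivAt (fun s => inner ℝ (ι (u s)) (ι p.1)) (f s (X p.1) - p.2 (u s)) s := by
    intro s
    have e := (ι.hasFDerivAt.comp_hasDerivAt s (h.hasDerivAt s)).inner ℝ
      (hasDerivAt_const s (ι p.1))
    refine e.congr_deriv ?_
    rw [← h.eq s p hp, inner_zero_right]
    ring
  have cu := h.continuous
  have cf := h.continuous_data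
  have c1 : Continuous fun s => f s (X p.1) := by fun_prop
  have c2 : Continuous fun s => p.2 (u s) := by fun_prop
  have hi := intervalIntegral.integral_eq_sub_of_hasDerivAt (a := 0) (b := t) (fun s _ => hd s)
    ((c1.sub c2).intervalIntegrable _ _)
  rw [intervalIntegral.integral_sub (c1.intervalIntegrable _ _) (c2.intervalIntegrable _ _),
    ← setIntegral_Ioo_eq_intervalIntegral t.2.1, ← setIntegral_Ioo_eq_intervalIntegral t.2.1] at hi
  have e1 : ∫ s in Ioo 0 (t : ℝ), p.2 (y.1.2 s) = ∫ s in Ioo 0 (t : ℝ), p.2 (u s) :=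
    integral_congr_ae ((h2.filter_mono (ae_mono (vol_mono t.2.2))).mono fun s hs =>
      congrArg p.2 hs)
  have e2 : ∫ s in Ioo 0 (t : ℝ), y.2.2 s (X p.1) = ∫ s in Ioo 0 (t : ℝ), f s (X p.1) :=
    integral_congr_ae ((h4.filter_mono (ae_mono (vol_mono t.2.2))).mono fun s hs =>
      congrArg (· (X p.1)) hs)
  rw [e1, e2, h1, h3]
  linarith

theorem IsDissipative.exists_norm_le (hd : IsDissipative ι X N α lam) (hT : 0 ≤ T) :
    ∃ C : ℝ, 0 < C ∧ ∀ y ∈ strongGraph ι X N T, ‖y.1‖ ≤ C * ‖y.2‖ := by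
  have hα := hd.pos
  have hl := hd.nonneg
  set K : ℝ := Real.exp (2 * lam * T) * (1 + ‖X‖ ^ 2 / α) with hK
  have hK0 : 0 ≤ K := by positivity
  have hKα : 0 ≤ K / α := by positivity
  -- The square of this constant dominates both `K` and `K / α`, the bounds for the two squared
  -- norms.
  refine ⟨1 + K + K / α, by positivity, ?_⟩
  rintro y ⟨u, u', f, h, h1, h2, h3, h4⟩
  have cu := h.continuous
  have cf := h.continuous_data
  have hU : ‖y.1.2‖ ^ 2 = ∫ s in (0 : ℝ)..T, ‖u s‖ ^ 2 := by
    rw [Lp_norm_sq, ← setIntegral_Ioo_eq_intervalIntegral hT]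
    exact integral_congr_ae (h2.mono fun s hs => by simp only [hs])
  have hF : ‖y.2.2‖ ^ 2 = ∫ s in (0 : ℝ)..T, ‖f s‖ ^ 2 := by
    rw [Lp_norm_sq, ← setIntegral_Ioo_eq_intervalIntegral hT]
    exact integral_congr_ae (h4.mono fun s hs => by simp only [hs])
  have key : ∀ t ∈ Icc 0 T, ‖ι (u t)‖ ^ 2 + α * ∫ s in (0 : ℝ)..t, ‖u s‖ ^ 2 ≤ K * ‖y.2‖ ^ 2 := by
    intro t ht
    refine (h.energy_le hd ht.1).trans ?_
    have a1 : ∫ s in (0 : ℝ)..t, ‖f s‖ ^ 2 ≤ ‖y.2‖ ^ 2 := by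
      have b1 : ∫ s in (0 : ℝ)..t, ‖f s‖ ^ 2 ≤ ∫ s in (0 : ℝ)..T, ‖f s‖ ^ 2 :=
        intervalIntegral.integral_mono_interval le_rfl ht.1 ht.2
          (Eventually.of_forall fun s => by positivity)
          (Continuous.intervalIntegrable (by fun_prop) _ _)
      rw [← hF] at b1
      exact b1.trans (pow_le_pow_left₀ (norm_nonneg _) (norm_snd_le y.2) 2)
    have a2 : ‖ι (u 0)‖ ^ 2 ≤ ‖y.2‖ ^ 2 := by
      rw [← h3]
      exact pow_le_pow_left₀ (norm_nonneg _) (norm_fst_le y.2) 2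
    have a3 : Real.exp (2 * lam * t) ≤ Real.exp (2 * lam * T) :=
      Real.exp_le_exp.2 (mul_le_mul_of_nonneg_left ht.2 (by positivity))
    have a4 : ‖ι (u 0)‖ ^ 2 + ‖X‖ ^ 2 / α * ∫ s in (0 : ℝ)..t, ‖f s‖ ^ 2
        ≤ (1 + ‖X‖ ^ 2 / α) * ‖y.2‖ ^ 2 := by
      have := mul_le_mul_of_nonneg_left a1 (by positivity : 0 ≤ ‖X‖ ^ 2 / α)
      linarith
    calc _ ≤ Real.exp (2 * lam * t) * ((1 + ‖X‖ ^ 2 / α) * ‖y.2‖ ^ 2) :=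
          mul_le_mul_of_nonneg_left a4 (Real.exp_nonneg _)
      _ ≤ Real.exp (2 * lam * T) * ((1 + ‖X‖ ^ 2 / α) * ‖y.2‖ ^ 2) :=
          mul_le_mul_of_nonneg_right a3 (by positivity)
      _ = _ := by rw [hK]; ring
  have hsq : ∀ a : ℝ, a ^ 2 ≤ K * ‖y.2‖ ^ 2 ∨ a ^ 2 ≤ K / α * ‖y.2‖ ^ 2 →
      a ≤ (1 + K + K / α) * ‖y.2‖ := by
    intro a ha
    refine le_of_sq_le_sq ?_ (by positivity)
    rw [mul_pow]
    rcases ha with ha | ha <;>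
      exact ha.trans (mul_le_mul_of_nonneg_right (by nlinarith) (by positivity))
  refine max_le ?_ ?_
  · refine (ContinuousMap.norm_le _ (by positivity)).2 fun t => hsq _ (Or.inl ?_)
    rw [h1]
    have b1 : 0 ≤ ∫ s in (0 : ℝ)..t, ‖u s‖ ^ 2 :=
      intervalIntegral.integral_nonneg t.2.1 fun s _ => by positivity
    have := key t t.2
    have := mul_nonneg hα.le b1
    linarith
  · refine hsq _ (Or.inr ?_)
    rw [hU, div_mul_eq_mul_div, le_div_iff₀ hα]
    have := key T ⟨hT, le_rfl⟩
    nlinarith [sq_nonneg ‖ι (u T)‖]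

/-- Let `Λ = (Λ₁, Λ₂)` annihilate all data of strong solutions. For fixed `l`, the solutions `e^{nt}
w` with forcing `e^{nt} l` have `w` bounded uniformly in `n`, so `Λ₂(e^{nt} l) = -Λ₁(ι w)` stays
bounded and the density of `Λ₂` in the direction `l` vanishes. With `Λ₂ = 0`, stationary solutions,
whose initial values are dense, force `Λ₁ = 0`. -/
theorem IsDissipative.dense_data [CompleteSpace V] [CompleteSpace H]
    (hd : IsDissipative ι X N α lam) (T : ℝ) :
    Dense (((strongGraph ι X N T).map (LinearMap.snd ℝ _ _) :
      Submodule ℝ (H × Lp (V →L[ℝ] ℝ) 2 (vol T))) : Set (H × Lp (V →L[ℝ] ℝ) 2 (vol T))) := by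
  refine dense_of_forall_dual _ fun Λ hΛ => ?_
  set Λ₁ : H →L[ℝ] ℝ := Λ.comp (ContinuousLinearMap.inl ℝ _ _) with hΛ₁
  set Λ₂ : Lp (V →L[ℝ] ℝ) 2 (vol T) →L[ℝ] ℝ := Λ.comp (ContinuousLinearMap.inr ℝ _ _) with hΛ₂
  have hsplit : ∀ y, Λ y = Λ₁ y.1 + Λ₂ y.2 := fun y => by
    rw [hΛ₁, hΛ₂, ContinuousLinearMap.comp_apply, ContinuousLinearMap.comp_apply, ← map_add]
    simp
  have hs : ∀ {u u' f}, IsStrongSol ι X N u u' f →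
      ∃ F : Lp (V →L[ℝ] ℝ) 2 (vol T), F =ᵐ[vol T] f ∧ Λ₁ (ι (u 0)) + Λ₂ F = 0 := by
    intro u u' f h
    obtain ⟨y, hy, h1, h2⟩ := h.exists_mem_strongGraph T
    refine ⟨y.2.2, h2, ?_⟩
    rw [← h1, ← hsplit]
    exact hΛ _ (Submodule.mem_map_of_mem hy)
  have hB : ∀ l : V →L[ℝ] ℝ,
      Λ₂.comp ((ContinuousLinearMap.toSpanSingleton ℝ l).compLpL 2 (vol T)) = 0 := by
    intro l
    set B := (ContinuousLinearMap.toSpanSingleton ℝ l).compLpL 2 (vol T) with hB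
    set g : Lp ℝ 2 (vol T) := (InnerProductSpace.toDual ℝ _).symm (Λ₂.comp B) with hg
    have hgB : ∀ F, inner ℝ g F = Λ₂ (B F) := fun F => by
      rw [hg, InnerProductSpace.toDual_symm_apply]; rfl
    obtain ⟨n₀, hn₀⟩ := exists_nat_ge lam
    have hg0 : g =ᵐ[vol T] 0 := by
      refine ae_eq_zero_of_bounded_moments (integrable_Lp g) (n₀ := n₀)
        (M := ‖Λ₁‖ * (‖ι‖ * (‖l.comp X‖ / α))) fun n hn => ?_
      obtain ⟨w, hw, hw'⟩ := hd.exists_resolvent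
        (hn₀.trans (Nat.cast_le.2 hn) : lam ≤ (n : ℝ)) (l.comp X)
      obtain ⟨F, hF, hF0⟩ := hs (IsStrongSol.exp hw')
      have ce : Continuous fun t : ℝ => Real.exp (n * t) := by fun_prop
      have e1 : B (ce.memLp_vol T).toLp = F := by
        refine Lp.ext ?_
        filter_upwards [(ContinuousLinearMap.toSpanSingleton ℝ l).coeFn_compLpL
          (ce.memLp_vol T).toLp, (ce.memLp_vol T).coeFn_toLp, hF] with t t1 t2 t3
        rw [t1, t2, t3, ContinuousLinearMap.toSpanSingleton_apply]
      have e2 := hgB (ce.memLp_vol T).toLp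
      rw [e1, L2.inner_def] at e2
      have e3 : ∫ t in Ioo 0 T, Real.exp (n * t) * g t = Λ₂ F := by
        rw [← e2]
        refine integral_congr_ae ?_
        filter_upwards [(ce.memLp_vol T).coeFn_toLp] with t ht
        rw [ht, real_inner_eq_re_inner]
        simp
      rw [mul_zero, Real.exp_zero, one_smul] at hF0
      rw [e3, ← abs_neg, ← eq_neg_of_add_eq_zero_left hF0]
      exact (Λ₁.le_opNorm _).trans (mul_le_mul_of_nonneg_left ((ι.le_opNorm _).trans
        (mul_le_mul_of_nonneg_left hw (norm_nonneg _))) (norm_nonneg _))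
    have hg0' : g = 0 := Lp.eq_zero_iff_ae_eq_zero.2 hg0
    ext F
    rw [ContinuousLinearMap.comp_apply, ← hgB, hg0', inner_zero_left]; rfl
  have h2 : ∀ F, Λ₂ F = 0 := by
    intro F
    -- Indicators times a constant functional generate the space, and each lies in the range of some
    -- map from `hB`.
    refine Lp.induction (by norm_num) (fun F => Λ₂ F = 0) ?_ ?_ ?_ F
    · intro l s hs hμ
      rw [Lp.simpleFunc.coe_indicatorConst, indicatorConstLp_eq_toSpanSingleton_compLp]
      exact DFunLike.congr_fun (hB l) _
    · intro f g hf hg _ h1 h2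
      rw [map_add, h1, h2, add_zero]
    · exact isClosed_eq Λ₂.continuous continuous_const
  have h1 : (InnerProductSpace.toDual ℝ H).symm Λ₁ = 0 := by
    refine hd.dense _ fun u ⟨l, hl⟩ => ?_
    obtain ⟨F, -, hF⟩ := hs (IsStrongSol.exp (ι := ι) (X := X) (N := N) (w := u) (l := l) (μ := 0)
      fun p hp => by rw [hl p hp, zero_mul, add_zero])
    rw [h2, add_zero, zero_mul, Real.exp_zero, one_smul] at hF
    rw [InnerProductSpace.toDual_symm_apply, hF]
  refine ContinuousLinearMap.ext fun y => ?_
  rw [hsplit, h2, (LinearIsometryEquiv.map_eq_zero_iff _).1 h1]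
  simp

/-- Each identity is continuous in the solution and the data; only the agreement of the two
representatives needs a subsequence converging almost everywhere. -/
theorem isWeakSol_of_tendsto {y : ℕ → SolData V H T} {z : SolData V H T}
    (hy : ∀ n, IsWeakSol ι X N (y n).1.1 (y n).1.2 (y n).2.1 (y n).2.2)
    (hz : Tendsto y atTop (𝓝 z)) : IsWeakSol ι X N z.1.1 z.1.2 z.2.1 z.2.2 := by
  have tc : Tendsto (fun n => (y n).1.1) atTop (𝓝 z.1.1) :=
    ((continuous_fst.comp continuous_fst).tendsto z).comp hz
  have tU : Tendsto (fun n => (y n).1.2) atTop (𝓝 z.1.2) :=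
    ((continuous_snd.comp continuous_fst).tendsto z).comp hz
  have tu : Tendsto (fun n => (y n).2.1) atTop (𝓝 z.2.1) :=
    ((continuous_fst.comp continuous_snd).tendsto z).comp hz
  have tf : Tendsto (fun n => (y n).2.2) atTop (𝓝 z.2.2) :=
    ((continuous_snd.comp continuous_snd).tendsto z).comp hz
  have tct : ∀ t, Tendsto (fun n => (y n).1.1 t) atTop (𝓝 (z.1.1 t)) := fun t =>
    ((continuous_eval_const t).tendsto z.1.1).comp tc
  refine ⟨fun h => ?_, ?_, fun p hp t => ?_⟩
  · refine tendsto_nhds_unique (tct _) (tu.congr fun n => ?_)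
    rw [(hy n).initial h]
  · obtain ⟨ns, hns, hns'⟩ := (tendstoInMeasure_of_tendsto_Lp tU).exists_seq_tendsto_ae
    have hall : ∀ᵐ t ∂(vol T), ∀ n, ∀ ht : t ∈ Icc (0 : ℝ) T,
        (y n).1.1 ⟨t, ht⟩ = ι ((y n).1.2 t) := ae_all_iff.2 fun n => (hy n).compat
    filter_upwards [hall, hns'] with t h1 h2 ht
    refine tendsto_nhds_unique ((tct ⟨t, ht⟩).comp hns.tendsto_atTop) ?_
    exact ((ι.continuous.tendsto _).comp h2).congr fun n => (h1 (ns n) ht).symm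
  · have e1 := (((tct t).inner (𝕜 := ℝ) (tendsto_const_nhds (x := ι p.1))).sub
      (tu.inner (𝕜 := ℝ) (tendsto_const_nhds (x := ι p.1)))).add
      (((timeIntegral T p.2 t).continuous.tendsto _).comp tU)
    have e2 := ((timeIntegral T (ContinuousLinearMap.apply ℝ ℝ (X p.1)) t).continuous.tendsto
      _).comp tf
    rw [timeIntegral_apply _ t.2.2] at e1 e2
    refine tendsto_nhds_unique e1 (e2.congr fun n => ?_)
    have := (hy n).weak p hp t
    rw [Function.comp_apply, Function.comp_apply, timeIntegral_apply _ t.2.2,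
      timeIntegral_apply _ t.2.2]
    exact this.symm

/-- Existence, with the a priori estimate. -/
theorem IsDissipative.exists_isWeakSol [CompleteSpace V] [CompleteSpace H]
    (hd : IsDissipative ι X N α lam) (hT : 0 ≤ T) :
    ∃ C : ℝ, 0 < C ∧ ∀ (u₀ : H) (f : Lp (V →L[ℝ] ℝ) 2 (vol T)), ∃ c U,
      IsWeakSol ι X N (T := T) c U u₀ f ∧ ‖c‖ + ‖U‖ ≤ C * (‖u₀‖ + ‖f‖) := by
  obtain ⟨C, hC, hle⟩ := hd.exists_norm_le hT
  refine ⟨2 * C, by positivity, fun u₀ f => ?_⟩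
  obtain ⟨d, hdm, hdt⟩ := mem_closure_iff_seq_limit.1 (hd.dense_data T (u₀, f))
  choose y hy hyd using hdm
  -- Strong solutions form a subspace, so the a priori bound applies to differences.
  have hcau : CauchySeq fun n => (y n).1 := by
    have hd' := Metric.cauchySeq_iff'.1 hdt.cauchySeq
    refine Metric.cauchySeq_iff'.2 fun ε hε => ?_
    obtain ⟨n, hn⟩ := hd' (ε / C) (by positivity)
    refine ⟨n, fun m hm => ?_⟩
    have h1 := hle _ ((strongGraph ι X N T).sub_mem (hy m) (hy n))
    have h2 := hn m hm
    rw [dist_eq_norm, lt_div_iff₀ hC] at h2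
    rw [dist_eq_norm]
    refine lt_of_le_of_lt h1 (lt_of_eq_of_lt ?_ h2)
    rw [← hyd m, ← hyd n, mul_comm]; rfl
  obtain ⟨z, hz⟩ := cauchySeq_tendsto_of_complete hcau
  have hdt' : Tendsto (fun n => (y n).2) atTop (𝓝 (u₀, f)) := hdt.congr fun n => (hyd n).symm
  have hw := isWeakSol_of_tendsto (fun n => isWeakSol_of_mem_strongGraph (hy n))
    (hz.prodMk_nhds hdt')
  refine ⟨z.1, z.2, hw, ?_⟩
  have hb : ‖z‖ ≤ C * ‖(u₀, f)‖ :=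
    le_of_tendsto_of_tendsto' hz.norm (hdt'.norm.const_mul C) fun n => hle _ (hy n)
  have h3 : ‖(u₀, f)‖ ≤ ‖u₀‖ + ‖f‖ :=
    max_le (le_add_of_nonneg_right (norm_nonneg _)) (le_add_of_nonneg_left (norm_nonneg _))
  have h4 := hb.trans (mul_le_mul_of_nonneg_left h3 hC.le)
  have h5 := norm_fst_le z
  have h6 := norm_snd_le z
  linarith

theorem integral_zero_Lp_apply {t : ℝ} (ht : t ≤ T) (x : V) :
    ∫ s in Ioo 0 t, (0 : Lp (V →L[ℝ] ℝ) 2 (vol T)) s x = 0 :=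
  (timeIntegral_apply (ContinuousLinearMap.apply ℝ ℝ x) ht 0).symm.trans (map_zero _)

theorem IsWeakSol.sub {c c' : C(Icc (0 : ℝ) T, H)} {U U' : Lp V 2 (vol T)} {u₀ : H}
    {f : Lp (V →L[ℝ] ℝ) 2 (vol T)} (h : IsWeakSol ι X N c U u₀ f)
    (h' : IsWeakSol ι X N c' U' u₀ f) : IsWeakSol ι X N (c - c') (U - U') 0 0 where
  initial h0 := by
    rw [ContinuousMap.sub_apply, h.initial h0, h'.initial h0, sub_self]
  compat := by
    filter_upwards [h.compat, h'.compat, Lp.coeFn_sub U U'] with t h1 h2 h3 ht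
    rw [h3, ContinuousMap.sub_apply, h1, h2, Pi.sub_apply, map_sub]
  weak p hp t := by
    have h1 := h.weak p hp t
    have h2 := h'.weak p hp t
    rw [← h2, ← timeIntegral_apply p.2 t.2.2, ← timeIntegral_apply p.2 t.2.2] at h1
    rw [integral_zero_Lp_apply t.2.2, ← timeIntegral_apply p.2 t.2.2, map_sub, ContinuousMap.sub_apply,
      inner_sub_left, inner_zero_left]
    linarith

/-- A weak solution has no time derivative in `V` to which the energy bound could be applied. Its
primitive `W` at time `t` lies in `V` and solves `A W = -c(t)`, so with `w = ι W` and `w' = c` one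
gets `⟨w, w'⟩ ≤ lam ‖w‖²`, and Gronwall gives `w = 0`. -/
theorem IsDissipative.eq_zero_of_isWeakSol [CompleteSpace V] [CompleteSpace H]
    (hd : IsDissipative ι X N α lam) (hT : 0 < T)
    {c : C(Icc (0 : ℝ) T, H)} {U : Lp V 2 (vol T)} (h : IsWeakSol ι X N c U 0 0) :
    c = 0 ∧ U = 0 := by
  have hα := hd.pos
  set b : ℝ → H := IccExtend hT.le c with hb
  have cb : Continuous b := c.continuous.Icc_extend'
  have hbc : ∀ t : Icc (0 : ℝ) T, b t = c t := fun t => IccExtend_val _ _ _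
  set w : ℝ → H := fun t => ∫ s in (0 : ℝ)..t, b s with hw
  have hwd : ∀ t, HasDerivAt w (b t) t := fun t => (cb.integral_hasStrictDerivAt 0 t).hasDerivAt
  have key : ∀ t ∈ Icc 0 T, inner ℝ (w t) (b t) ≤ lam * ‖w t‖ ^ 2 := by
    intro t ht
    set W : V := ∫ s in Ioo 0 t, U s with hW
    have hUi := integrable_Lp_restrict ht.2 U
    have hιW : ι W = w t := by
      rw [hW, ← ι.integral_comp_comm hUi, hw]
      simp only
      rw [intervalIntegral.integral_of_le ht.1, integral_Ioc_eq_integral_Ioo]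
      refine integral_congr_ae ?_
      filter_upwards [h.compat.filter_mono (ae_mono (vol_mono ht.2)), ae_restrict_mem measurableSet_Ioo]
        with s h1 hs
      have hs' : s ∈ Icc 0 T := ⟨hs.1.le, hs.2.le.trans ht.2⟩
      rw [← h1 hs', ← hbc ⟨s, hs'⟩]
    have he := hd.energy W (-(innerSL ℝ (b t)).comp ι) fun p hp => by
      have h1 := h.weak p hp ⟨t, ht⟩
      rw [integral_zero_Lp_apply ht.2, p.2.integral_comp_comm hUi, inner_zero_left, ← hbc ⟨t, ht⟩] at h1
      rw [neg_apply, ContinuousLinearMap.comp_apply, innerSL_apply_apply]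
      linarith
    rw [neg_apply, ContinuousLinearMap.comp_apply, innerSL_apply_apply, hιW,
      real_inner_comm] at he
    nlinarith [sq_nonneg ‖W‖]
  let E : ℝ → ℝ := fun t => Real.exp (-(2 * lam) * t) * ‖w t‖ ^ 2
  have hE : ∀ t, HasDerivAt E (Real.exp (-(2 * lam) * t) * (2 * inner ℝ (w t) (b t)
      - 2 * lam * ‖w t‖ ^ 2)) t := by
    intro t
    have h3 := ((hasDerivAt_id t).const_mul (-(2 * lam))).exp
    refine (h3.fun_mul (hwd t).norm_sq).congr_deriv ?_
    simp only [id, mul_one]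
    ring
  have hanti : AntitoneOn E (Icc 0 T) := by
    refine antitoneOn_of_deriv_nonpos (convex_Icc 0 T)
      (fun t _ => (hE t).continuousAt.continuousWithinAt)
      (fun t _ => (hE t).differentiableAt.differentiableWithinAt) fun t ht => ?_
    rw [(hE t).deriv]
    refine mul_nonpos_of_nonneg_of_nonpos (Real.exp_nonneg _) ?_
    have := key t (interior_subset ht)
    linarith
  have hw0 : ∀ t ∈ Icc 0 T, w t = 0 := by
    intro t ht
    have h1 := hanti (left_mem_Icc.2 hT.le) ht ht.1
    have h2 : E 0 = 0 := by simp [E, hw]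
    rw [h2] at h1
    have h3 : ‖w t‖ ^ 2 ≤ 0 := by
      by_contra! h4
      exact absurd h1 (not_le.2 (mul_pos (Real.exp_pos _) h4))
    exact norm_eq_zero.1 (pow_eq_zero_iff two_ne_zero |>.1 (le_antisymm h3 (sq_nonneg _)))
  have hb0 : ∀ t ∈ Icc 0 T, b t = 0 := fun t ht =>
    (uniqueDiffOn_Icc hT t ht).eq_deriv _ (hwd t).hasDerivWithinAt
      ((hasDerivWithinAt_const t _ (0 : H)).congr hw0 (hw0 t ht))
  have hc0 : c = 0 := by
    ext t
    rw [← hbc, hb0 _ t.2]; rfl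
  refine ⟨hc0, Lp.eq_zero_iff_ae_eq_zero.2 ?_⟩
  filter_upwards [h.compat, ae_restrict_mem measurableSet_Ioo] with t h1 ht
  have h2 := h1 (Ioo_subset_Icc_self ht)
  rw [hc0] at h2
  exact hd.inj (h2.symm.trans (map_zero ι).symm)

end Abstract

end

end Kawahara

/-! ### From admissible test functions to the abstract equation. -/

namespace Kawahara

open Filter Topology

noncomputable section

variable {L : ℝ}

/-! ### Division by `x` of smooth functions -/

/-- The factor `s ^ k` makes this family of integrals stable under differentiation, which allows the
induction on smoothness. -/
theorem hasDerivAt_integral_pow_mul_comp {f : ℝ → ℝ} (hf : ContDiff ℝ ∞ f) (k : ℕ) (x : ℝ) :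
    HasDerivAt (fun x => ∫ s in (0 : ℝ)..1, s ^ k * f (s * x))
      (∫ s in (0 : ℝ)..1, s ^ (k + 1) * deriv f (s * x)) x := by
  have cf := hf.continuous
  have cf' := hf.deriv_infty.continuous
  obtain ⟨C, hC⟩ := (isCompact_closedBall (0 : ℝ) (|x| + 1)).exists_bound_of_continuousOn
    cf'.continuousOn
  refine (intervalIntegral.hasDerivAt_integral_of_dominated_loc_of_deriv_le
    (F := fun x s => s ^ k * f (s * x)) (F' := fun x s => s ^ (k + 1) * deriv f (s * x))
    (bound := fun _ => C) (Metric.ball_mem_nhds x one_pos)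
    (Eventually.of_forall fun y => Continuous.aestronglyMeasurable (by fun_prop))
    (Continuous.intervalIntegrable (by fun_prop) _ _)
    (Continuous.aestronglyMeasurable (by fun_prop)) (Eventually.of_forall fun s hs y hy => ?_)
    (intervalIntegrable_const) (Eventually.of_forall fun s _ y _ => ?_)).2
  · rw [uIoc_of_le zero_le_one] at hs
    have h1 : |s| ≤ 1 := by rw [abs_of_pos hs.1]; exact hs.2
    have h2 : |y| ≤ |x| + 1 := by
      have := abs_sub_abs_le_abs_sub y x
      rw [Metric.mem_ball, Real.dist_eq] at hy
      linarith
    have h3 : s * y ∈ Metric.closedBall (0 : ℝ) (|x| + 1) := by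
      rw [mem_closedBall_zero_iff, Real.norm_eq_abs, abs_mul]
      nlinarith [abs_nonneg s, abs_nonneg y]
    rw [norm_mul, norm_pow, Real.norm_eq_abs s]
    calc |s| ^ (k + 1) * ‖deriv f (s * y)‖ ≤ 1 * ‖deriv f (s * y)‖ :=
          mul_le_mul_of_nonneg_right (pow_le_one₀ (abs_nonneg s) h1) (norm_nonneg _)
      _ ≤ C := by rw [one_mul]; exact hC _ h3
  · have h1 := (hf.differentiable_infty (s * y)).hasDerivAt
    have h2 := (h1.comp y ((hasDerivAt_id y).const_mul s)).const_mul (s ^ k)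
    refine h2.congr_deriv ?_
    rw [mul_one, pow_succ]; ring

theorem contDiff_integral_pow_mul_comp {f : ℝ → ℝ} (hf : ContDiff ℝ ∞ f) (k : ℕ) :
    ContDiff ℝ ∞ fun x => ∫ s in (0 : ℝ)..1, s ^ k * f (s * x) := by
  rw [contDiff_infty]
  intro n
  induction n generalizing f k with
  | zero =>
    exact contDiff_zero.2 (continuous_iff_continuousAt.2 fun x =>
      (hasDerivAt_integral_pow_mul_comp hf k x).continuousAt)
  | succ n ih =>
    have hd := hasDerivAt_integral_pow_mul_comp hf k
    rw [Nat.cast_add, Nat.cast_one]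
    refine contDiff_succ_iff_deriv.2 ⟨fun x => (hd x).differentiableAt, by simp, ?_⟩
    rw [funext fun x => (hd x).deriv]
    exact ih hf.deriv_infty (k + 1)

/-- Hadamard's lemma. -/
theorem exists_contDiff_eq_mul {f : ℝ → ℝ} (hf : ContDiff ℝ ∞ f) (h0 : f 0 = 0) :
    ∃ v, ContDiff ℝ ∞ v ∧ f = fun x => x * v x := by
  -- The quotient is `v(x) = ∫₀¹ f'(s x) ds`.
  refine ⟨_, contDiff_integral_pow_mul_comp hf.deriv_infty 0, funext fun x => ?_⟩
  have cf' := hf.deriv_infty.continuous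
  have h := intervalIntegral.integral_eq_sub_of_hasDerivAt (a := 0) (b := 1)
    (f := fun s => f (s * x)) (f' := fun s => deriv f (s * x) * x) (fun s _ => by
      have := (hf.differentiable_infty (s * x)).hasDerivAt.comp s
        ((hasDerivAt_id s).mul_const x)
      rw [one_mul] at this
      exact this) (Continuous.intervalIntegrable (by fun_prop) _ _)
  rw [zero_mul, one_mul, h0, sub_zero, intervalIntegral.integral_mul_const] at h
  simp only [pow_zero, one_mul]
  rw [← h, mul_comm]

/-! ### Test functions of the weak formulation -/

theorem iteratedDeriv_two_eq (f : ℝ → ℝ) : iteratedDeriv 2 f = deriv (deriv f) := by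
  rw [iteratedDeriv_succ, iteratedDeriv_one]

theorem iteratedDeriv_three_eq (f : ℝ → ℝ) : iteratedDeriv 3 f = deriv (deriv (deriv f)) := by
  rw [iteratedDeriv_succ, iteratedDeriv_two_eq]

theorem V.D_zero_mulX (hL : 0 ≤ L) (u : V L) : V.D 0 (V.mulX hL u) = Kawahara.mulX L (V.D 0 u) := by
  rw [V.D_eq, V.toH2_mulX, H2.D_zero_mulX, V.D_eq]

/-- Admissible test functions are those of the form `x v`, where `v` belongs to `coreGraph`. -/
theorem IsAdmissible.exists_core (hL : 0 < L) {ψ : ℝ → ℝ} {w : H20 L} (h : IsAdmissible L ψ w) :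
    ∃ (p : V L × L2 L) (v : ℝ → ℝ), ContDiff ℝ ∞ v ∧ V.D 0 p.1 = toL2 L v ∧
      (p.2 = toL2 L fun x => x * deriv (deriv (deriv v)) x) ∧ (ψ = fun x => x * v x) ∧
      V.ofH20 L w = V.mulX hL.le p.1 := by
  have hD : V.D 0 (V.ofH20 L w) = toL2 L ψ := eq_toL2 h.smooth.continuous h.eq
  obtain ⟨b0, b1, b2, b3⟩ := V.boundary _ hL h.smooth hD
  have b4 := h.deriv_two_zero
  -- For `ψ = x v`: `ψ'(0) = v(0)`, `ψ''(0) = 2 v'(0)`, `ψ(L) = L v(L)` and `ψ'(L) = v(L) + L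
  -- v'(L)`, so the conditions on `ψ` say that `v` vanishes to first order at both ends.
  obtain ⟨v, hv, rfl⟩ := exists_contDiff_eq_mul h.smooth b0
  rw [iteratedDeriv_two_eq, deriv_deriv_id_mul hv] at b4
  rw [deriv_id_mul hv] at b1 b3
  simp only [zero_mul, add_zero] at b1 b4
  have e1 : v L = 0 := (mul_eq_zero.1 b2).resolve_left hL.ne'
  simp only [e1, zero_add] at b3
  obtain ⟨u, hu⟩ := V.exists_of_smooth hL hv b1 ((mul_eq_zero.1 b4).resolve_left two_ne_zero) e1
    ((mul_eq_zero.1 b3).resolve_left hL.ne')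
  refine ⟨(u, _), v, hv, hu, rfl, rfl, Subtype.ext (H2.ext_D0 ?_)⟩
  refine hD.trans ?_
  rw [← mulX_toL2 hv.continuous, ← hu]
  exact (V.D_zero_mulX hL.le u).symm

theorem isAdmissible_of_core (hL : 0 < L) {u : V L} {v : ℝ → ℝ} (hv : ContDiff ℝ ∞ v)
    (hu : V.D 0 u = toL2 L v) :
    IsAdmissible L (fun x => x * v x) (V.toH20 L (V.mulX hL.le u)) := by
  refine ⟨contDiff_id.mul hv, ?_, ?_⟩
  · have h : H2.D 0 (V.toH2 L (V.mulX hL.le u)) = toL2 L fun x => x * v x := by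
      rw [← V.D_eq, V.D_zero_mulX, hu, mulX_toL2 hv.continuous]
    rw [V.coe_toH20, h]
    exact toL2_coe (continuous_id.mul hv.continuous)
  · obtain ⟨-, b1, -⟩ := V.boundary _ hL hv hu
    rw [iteratedDeriv_two_eq, deriv_deriv_id_mul hv]
    simp [b1]

/-- The spatial part of the weak formulation. -/
theorem integral_eq_form (hL : 0 < L) {p : V L × L2 L} {v : ℝ → ℝ} (hv : ContDiff ℝ ∞ v)
    (h1 : V.D 0 p.1 = toL2 L v) (h2 : p.2 = toL2 L fun x => x * deriv (deriv (deriv v)) x)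
    (u : V L) :
    (∫ x in Ioo 0 L, V.D 1 u x * (x * v x))
        - (∫ x in Ioo 0 L, V.D 2 u x * deriv (fun x => x * v x) x)
        + (∫ x in Ioo 0 L, V.D 2 u x * iteratedDeriv 3 (fun x => x * v x) x) = form L p u := by
  have hψ : ContDiff ℝ ∞ fun x => x * v x := contDiff_id.mul hv
  rw [form_eq hL hv h1 h2, inner_toL2 _ hψ.continuous, inner_toL2 _ hψ.deriv_infty.continuous,
    inner_toL2 _ hψ.deriv_infty.deriv_infty.deriv_infty.continuous, iteratedDeriv_three_eq]

theorem inner_emb_of_eq_toL2 {u : V L} {v : ℝ → ℝ} (hv : ContDiff ℝ ∞ v)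
    (hu : V.D 0 u = toL2 L v) (c : L2x L) :
    inner ℝ c (V.emb L u) = ∫ x in Ioo 0 L, c x * (x * v x) := by
  rw [V.emb, ContinuousLinearMap.comp_apply, inner_emb_right, hu]
  refine integral_congr_ae ?_
  filter_upwards [toL2_coe (L := L) hv.continuous] with x hx
  rw [hx]

/-! ### The Kawahara equation as an abstract evolution equation -/

theorem V.emb_injective (L : ℝ) : Function.Injective (V.emb L) := by
  rw [injective_iff_map_eq_zero]
  intro u hu
  have h0 : V.D 0 u = 0 := by
    refine Lp.ext ?_
    have h1 := emb_coe (V.D 0 u)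
    have h2 : Kawahara.emb L (V.D 0 u) = 0 := hu
    rw [h2] at h1
    exact h1.symm.trans (((vol_ac L).ae_eq (Lp.coeFn_zero ℝ 2 (xvol L))).trans
      (Lp.coeFn_zero ℝ 2 (vol L)).symm)
  exact Subtype.ext (H2.ext_D0 h0)

instance (L : ℝ) : IsFiniteMeasure (xvol L) :=
  have : IsFiniteMeasure (ENNReal.ofReal L • vol L) :=
    (vol L).smul_finite ENNReal.ofReal_ne_top
  isFiniteMeasure_of_le _ (xvol_le L)

/-- An element of the weighted space need not be integrable near `0`, but `x h` is; the fundamental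
lemma is applied to it. -/
theorem L2x_eq_zero_of_test (h : L2x L)
    (hh : ∀ φ, IsTest L φ → ∫ x in Ioo 0 L, h x * (x * φ x) = 0) : h = 0 := by
  have hi : Integrable (fun x => h x) (xvol L) := (Lp.memLp h).integrable (by norm_num)
  have hi' : IntegrableOn (fun x => (ENNReal.ofReal x).toReal • h x) (Ioo 0 L) :=
    (integrable_withDensity_iff_integrable_smul' (by fun_prop)
      (Eventually.of_forall fun _ => ENNReal.ofReal_lt_top)).1 hi
  have h0 := isOpen_Ioo.ae_eq_zero_of_integral_contDiff_smul_eq_zero (μ := volume)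
    hi'.locallyIntegrableOn fun g hg hc hs => by
      have h2 := hh g ⟨hg, hc, hs⟩
      rw [← h2, ← setIntegral_eq_integral_of_forall_compl_eq_zero (s := Ioo 0 L)]
      · refine setIntegral_congr_fun measurableSet_Ioo fun x hx => ?_
        simp only [smul_eq_mul, ENNReal.toReal_ofReal hx.1.le]
        ring
      · intro x hx
        rw [image_eq_zero_of_notMem_tsupport fun h' => hx (hs h'), zero_smul]
  refine L2x_ext ?_
  refine EventuallyEq.trans ?_ ((vol_ac L).ae_eq (Lp.coeFn_zero ℝ 2 (xvol L))).symm
  rw [EventuallyEq, ae_restrict_iff' measurableSet_Ioo]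
  filter_upwards [h0] with x hx hxL
  have := hx hxL
  rw [ENNReal.toReal_ofReal hxL.1.le, smul_eq_mul] at this
  exact (mul_eq_zero.1 this).resolve_left hxL.1.ne'

/-- The graph of the spatial operator of the Kawahara equation. -/
def operatorGraph (L : ℝ) : Submodule ℝ (V L × (V L →L[ℝ] ℝ)) :=
  (coreGraph L).map ((LinearMap.fst ℝ (V L) (L2 L)).prod (form L))

theorem mem_operatorGraph {p : V L × L2 L} (hp : p ∈ coreGraph L) :
    (p.1, form L p) ∈ operatorGraph L :=
  Submodule.mem_map_of_mem (f := (LinearMap.fst ℝ (V L) (L2 L)).prod (form L)) hp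

theorem isDissipative (hL : 0 < L) :
    IsDissipative (V.emb L) (V.mulX hL.le) (operatorGraph L) (V.pconst L)⁻¹ (L / 2) where
  pos := inv_pos.2 (V.pconst_pos L)
  nonneg := by positivity
  inj := V.emb_injective L
  energy u M h := by
    rw [energy_identity hL u M fun p hp => h _ (mem_operatorGraph hp)]
    exact garding hL u
  coercive := by
    rintro _ ⟨p, hp, rfl⟩
    have h1 := form_core_self_ge hL hp
    have h2 := garding hL p.1
    exact h2.trans (add_le_add_left h1 _)
  dense h hh := by
    refine L2x_eq_zero_of_test h fun φ hφ => ?_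
    obtain ⟨u, hu⟩ := V.exists_of_smooth hL hφ.smooth hφ.at_zero hφ.deriv.at_zero hφ.at_end
      hφ.deriv.at_end
    rw [← inner_emb_of_eq_toL2 hφ.smooth hu]
    obtain ⟨l, hl⟩ := exists_functional_of_test hL hφ hu
    refine hh u ⟨l, ?_⟩
    rintro _ ⟨p, hp, rfl⟩
    exact hl p hp

end

end Kawahara

/-! ### Transfer to the spaces of the statement. -/

namespace Kawahara

open Filter Topology

noncomputable section

/-! ### Passing between the spaces of the statement and `V` -/

section Transfer

variable {T : ℝ}

theorem exists_Lp_comp {E F : Type*} {_ : NormedAddCommGroup E} {_ : NormedAddCommGroup F}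
    {g : E → F} (hg : LipschitzWith 1 g) (h0 : g 0 = 0) (f : Lp E 2 (vol T)) :
    ∃ G : Lp F 2 (vol T), (G =ᵐ[vol T] fun t => g (f t)) ∧ ‖G‖ ≤ ‖f‖ :=
  ⟨hg.compLp h0 f, hg.coeFn_compLp h0 f, by simpa using hg.norm_compLp_le h0 f⟩

/-- The adjoint of an isometry is a continuous left inverse, which makes the lift measurable and
square integrable. -/
theorem exists_Lp_lift {E F : Type*} [NormedAddCommGroup E] [InnerProductSpace ℝ E]
    [CompleteSpace E] [NormedAddCommGroup F] [InnerProductSpace ℝ F] [CompleteSpace F]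
    (j : F →L[ℝ] E) (hj : ∀ u, ‖j u‖ = ‖u‖) (U : Lp E 2 (vol T))
    (hU : ∀ᵐ t ∂(vol T), ∃ u, j u = U t) :
    ∃ G : Lp F 2 (vol T), U =ᵐ[vol T] fun t => j (G t) := by
  refine ⟨(ContinuousLinearMap.adjoint j).compLp U, ?_⟩
  filter_upwards [hU, (ContinuousLinearMap.adjoint j).coeFn_compLp U] with t ⟨u, hu⟩ h
  have := DFunLike.congr_fun ((ContinuousLinearMap.norm_map_iff_adjoint_comp_self j).1 hj) u
  rw [ContinuousLinearMap.comp_apply, one_apply_eq_self] at this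
  rw [h, ← hu, this]

end Transfer

variable {L T : ℝ}

theorem lipschitzWith_ofHm2 (L : ℝ) : LipschitzWith 1 (V.ofHm2 : Hm2 L → V L →L[ℝ] ℝ) :=
  LipschitzWith.of_dist_le_mul fun f g => by
    rw [NNReal.coe_one, one_mul, dist_eq_norm, dist_eq_norm]
    exact V.norm_ofHm2_le (f - g)

theorem lipschitzWith_toH2 (L : ℝ) : LipschitzWith 1 (V.toH2 L) :=
  LipschitzWith.of_dist_le_mul fun f g => by
    rw [NNReal.coe_one, one_mul, dist_eq_norm, dist_eq_norm, ← map_sub, V.norm_toH2]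

theorem exists_toH2_eq {u : H2 L} (hu : u ∈ H20 L) : ∃ v : V L, V.toH2 L v = u :=
  ⟨V.ofH20 L ⟨u, hu⟩, rfl⟩

theorem ae_eq_D_zero_iff (c : L2x L) (u : V L) :
    c =ᵐ[vol L] H2.D 0 (V.toH2 L u) ↔ c = V.emb L u := by
  have h : V.emb L u =ᵐ[vol L] H2.D 0 (V.toH2 L u) := emb_coe (V.D 0 u)
  refine ⟨fun hc => L2x_ext (hc.trans h.symm), ?_⟩
  rintro rfl
  exact h

/-- Admissible `ψ` and core vectors `v` correspond through `ψ = x v`, and the two weak identities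
then agree term by term. -/
theorem isSolution_iff (hL : 0 < L) {u₀ : L2x L} {f : L2Hm2 L T} {u : SolSpace L T}
    {U : Lp (V L) 2 (vol T)} {F : Lp (V L →L[ℝ] ℝ) 2 (vol T)}
    (hU : u.toL2H2 =ᵐ[vol T] fun t => V.toH2 L (U t))
    (hF : F =ᵐ[vol T] fun t => V.ofHm2 (f t)) :
    IsSolution u₀ f u ↔
      IsWeakSol (V.emb L) (V.mulX hL.le) (operatorGraph L) u.toC U u₀ F := by
  have hcompat : ∀ᵐ t ∂(vol T), ∀ ht : t ∈ Icc (0 : ℝ) T, u.toC ⟨t, ht⟩ = V.emb L (U t) := by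
    filter_upwards [hU, u.compat] with t h1 h2 ht
    rw [← ae_eq_D_zero_iff, ← h1]
    exact h2 ht
  have key : ∀ {p : V L × L2 L} {v : ℝ → ℝ}, ContDiff ℝ ∞ v → V.D 0 p.1 = toL2 L v →
      (p.2 = toL2 L fun x => x * deriv (deriv (deriv v)) x) → ∀ (w : H20 L),
      V.ofH20 L w = V.mulX hL.le p.1 → ∀ t : Icc (0 : ℝ) T,
      ((∫ x in Ioo 0 L, u.toC t x * (x * v x)) - (∫ x in Ioo 0 L, u₀ x * (x * v x))
        + (∫ s in Ioo 0 (t : ℝ),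
          ((∫ x in Ioo 0 L, H2.D 1 (u.toL2H2 s) x * (x * v x))
            - (∫ x in Ioo 0 L, H2.D 2 (u.toL2H2 s) x * deriv (fun x => x * v x) x)
            + (∫ x in Ioo 0 L, H2.D 2 (u.toL2H2 s) x * iteratedDeriv 3 (fun x => x * v x) x)))
        = ∫ s in Ioo 0 (t : ℝ), f s w) ↔
      inner ℝ (u.toC t) (V.emb L p.1) - inner ℝ u₀ (V.emb L p.1)
        + ∫ s in Ioo 0 (t : ℝ), form L p (U s)
        = ∫ s in Ioo 0 (t : ℝ), F s (V.mulX hL.le p.1) := by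
    intro p v hv h1 h2 w hw t
    have hm := ae_mono (vol_mono t.2.2)
    rw [inner_emb_of_eq_toL2 hv h1, inner_emb_of_eq_toL2 hv h1]
    have e1 : ∫ s in Ioo 0 (t : ℝ), F s (V.mulX hL.le p.1) = ∫ s in Ioo 0 (t : ℝ), f s w := by
      refine integral_congr_ae ?_
      filter_upwards [hF.filter_mono hm] with s hs
      rw [hs, ← hw]; rfl
    rw [e1]
    refine Eq.congr_left (congrArg _ (integral_congr_ae ?_))
    filter_upwards [hU.filter_mono hm] with s hs
    rw [hs]
    exact integral_eq_form hL hv h1 h2 (U s)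
  constructor
  · intro h
    refine ⟨h.initial, hcompat, ?_⟩
    rintro _ ⟨p, ⟨v, hv, h1, h2⟩, rfl⟩ t
    exact (key hv h1 h2 (V.toH20 L (V.mulX hL.le p.1)) rfl t).1
      (h.weak _ _ (isAdmissible_of_core hL hv h1) t)
  · intro h
    refine ⟨h.initial, ?_, fun ψ w hψ t => ?_⟩
    · filter_upwards [hU] with t ht
      rw [ht]
      exact V.toH2_mem _
    · obtain ⟨p, v, hv, h1, h2, rfl, hw⟩ := hψ.exists_core hL
      exact (key hv h1 h2 w hw t).2 (h.weak _ (mem_operatorGraph ⟨v, hv, h1, h2⟩) t)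

theorem IsSolution.exists_lift {u₀ : L2x L} {f : L2Hm2 L T} {u : SolSpace L T}
    (h : IsSolution u₀ f u) :
    ∃ U : Lp (V L) 2 (vol T), u.toL2H2 =ᵐ[vol T] fun t => V.toH2 L (U t) :=
  exists_Lp_lift (V.toH2 L) V.norm_toH2 u.toL2H2 (h.boundary.mono fun _ ht => exists_toH2_eq ht)

theorem IsSolution.unique (hL : 0 < L) (hT : 0 < T) {u₀ : L2x L} {f : L2Hm2 L T}
    {u v : SolSpace L T} (hu : IsSolution u₀ f u) (hv : IsSolution u₀ f v) : u = v := by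
  obtain ⟨F, hF, -⟩ := exists_Lp_comp (lipschitzWith_ofHm2 L) rfl f
  obtain ⟨U, hU⟩ := hu.exists_lift
  obtain ⟨W, hW⟩ := hv.exists_lift
  obtain ⟨h1, h2⟩ := (isDissipative hL).eq_zero_of_isWeakSol hT
    (((isSolution_iff hL hU hF).1 hu).sub ((isSolution_iff hL hW hF).1 hv))
  refine SolSpace.ext (sub_eq_zero.1 h1) (Lp.ext (hU.trans ?_))
  rw [sub_eq_zero.1 h2]
  exact hW.symm

theorem exists_isSolution (hL : 0 < L) (hT : 0 ≤ T) :
    ∃ C : ℝ, 0 < C ∧ ∀ (u₀ : L2x L) (f : L2Hm2 L T), ∃ u : SolSpace L T,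
      IsSolution u₀ f u ∧ ‖u.toC‖ + ‖u.toL2H2‖ ≤ C * (‖u₀‖ + ‖f‖) := by
  obtain ⟨C, hC, h⟩ := (isDissipative hL).exists_isWeakSol hT
  refine ⟨C, hC, fun u₀ f => ?_⟩
  obtain ⟨F, hF, hFf⟩ := exists_Lp_comp (lipschitzWith_ofHm2 L) rfl f
  obtain ⟨c, U, hw, hle⟩ := h u₀ F
  obtain ⟨G, hG, hGU⟩ := exists_Lp_comp (lipschitzWith_toH2 L) (map_zero _) U
  let u : SolSpace L T := ⟨c, G, by
    filter_upwards [hG, hw.compat] with t h1 h2 ht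
    rw [h1, ae_eq_D_zero_iff]
    exact h2 ht⟩
  refine ⟨u, (isSolution_iff hL (u := u) hG hF).2 hw, ?_⟩
  calc ‖c‖ + ‖G‖ ≤ ‖c‖ + ‖U‖ := by gcongr
    _ ≤ C * (‖u₀‖ + ‖F‖) := hle
    _ ≤ C * (‖u₀‖ + ‖f‖) := by gcongr

end

end Kawahara

theorem mainTheorem6 (L T : ℝ) (hL : 0 < L) (hT : 0 < T) :
    ∃ C : ℝ, 0 < C ∧ ∀ (u₀ : Kawahara.L2x L) (f : Kawahara.L2Hm2 L T),
      (∃! u : Kawahara.SolSpace L T, Kawahara.IsSolution u₀ f u) ∧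
      ∀ u : Kawahara.SolSpace L T, Kawahara.IsSolution u₀ f u →
        ‖u.toC‖ + ‖u.toL2H2‖ ≤ C * (‖u₀‖ + ‖f‖) := by
  obtain ⟨C, hC, h⟩ := Kawahara.exists_isSolution hL hT.le
  refine ⟨C, hC, fun u₀ f => ?_⟩
  obtain ⟨u, hu, hle⟩ := h u₀ f
  exact ⟨⟨u, hu, fun v hv => hv.unique hL hT hu⟩, fun v hv => hv.unique hL hT hu ▸ hle⟩
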